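/- Let $d>1$ be a square-free integer, let $K_d=\mathbb{Q}(\sqrt d)$ be the associated real quadratic field, let $D$ be its discriminant (so $D=d$ if $d\equiv 1 \pmod 4$ and $D=4d$ if $d\equiv 2,3\pmod 4$), let $h_d$ be its class number, and let $n_d$ be the number of rational primes that ramify in $K_d$. A prime discriminant is the discriminant of a quadratic field that is divisible by exactly one prime number. Then $h_d$ is odd if and only if either $n_d=1$, or $D=d_1d_2$ for some prime discriminants $d_1<0$ and $d_2<0$. -/

import Mathlib

open NumberField

/-- The field `K_d = ℚ(√d)`, as a subfield of `ℝ` (used for `d > 1` square-free, that is, for the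
real quadratic fields). -/
noncomputable abbrev realQuadraticField (d : ℤ) : IntermediateField ℚ ℝ :=
  IntermediateField.adjoin ℚ {Real.sqrt (d : ℝ)}

instance realQuadraticField.instNumberField (d : ℤ) : NumberField (realQuadraticField d) where
  to_charZero := inferInstance
  to_finiteDimensional := by
    refine IntermediateField.adjoin.finiteDimensional (IsIntegral.of_pow (n := 2) (by norm_num) ?_)
    rcases le_total 0 (d : ℝ) with h | h
    · rw [Real.sq_sqrt h]
      exact isIntegral_algebraMap_iff (algebraMap ℚ ℝ).injective |>.mpr
        (isIntegral_algebraMap (x := (d : ℚ))) |> fun h => by simpa using h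
    · rw [Real.sqrt_eq_zero_of_nonpos h]
      simpa using isIntegral_zero

/-- The number of rational primes that ramify in a number field `K`. -/
noncomputable def numRamifiedPrimes (K : Type*) [Field K] [NumberField K] : ℕ :=
  {p : ℕ | p.Prime ∧ ¬ Algebra.IsUnramifiedIn (𝓞 K) (Ideal.span {(p : ℤ)})}.ncard

/-- `m` is the discriminant of a quadratic field `ℚ(√e)`, where `e ≠ 1` is square-free: it is `e`
if `e ≡ 1 (mod 4)` and `4 * e` if `e ≡ 2, 3 (mod 4)`. -/
def IsQuadraticDiscriminant (m : ℤ) : Prop :=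
  ∃ e : ℤ, Squarefree e ∧ e ≠ 1 ∧ m = if e % 4 = 1 then e else 4 * e

/-- A prime discriminant: the discriminant of a quadratic field that is divisible by exactly one
rational prime. -/
def IsPrimeDiscriminant (m : ℤ) : Prop :=
  IsQuadraticDiscriminant m ∧ ∃! p : ℕ, p.Prime ∧ (p : ℤ) ∣ m

namespace RealQuadratic

variable {d : ℤ}

theorem irrational_sqrt (hd : 1 < d) (hsq : Squarefree d) : Irrational (Real.sqrt (d : ℝ)) := by
  have h : ¬ IsSquare d := by
    rintro ⟨r, rfl⟩
    have := Int.isUnit_iff.mp (hsq r dvd_rfl)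
    rcases this with rfl | rfl <;> simp at hd
  rw [irrational_sqrt_intCast_iff]
  exact ⟨h, by omega⟩

/-- The element `√d` of `ℚ(√d)`. -/
noncomputable def root (d : ℤ) : realQuadraticField d :=
  ⟨Real.sqrt (d : ℝ), IntermediateField.mem_adjoin_simple_self ℚ _⟩

theorem root_sq (hd : 1 < d) : root d ^ 2 = (d : realQuadraticField d) := by
  apply Subtype.ext
  have : (0 : ℝ) ≤ d := by exact_mod_cast (by omega : (0 : ℤ) ≤ d)
  simp [root, Real.sq_sqrt this]

theorem exists_coords (hd : 1 < d) (hsq : Squarefree d) (x : realQuadraticField d) :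
    ∃ a b : ℚ, x = (a : realQuadraticField d) + b * root d := by
  obtain ⟨x, hx⟩ := x
  have h0 : (0 : ℝ) ≤ d := by exact_mod_cast (by omega : (0 : ℤ) ≤ d)
  have hs : Real.sqrt (d : ℝ) ^ 2 = d := Real.sq_sqrt h0
  have key : ∃ a b : ℚ, x = (a : ℝ) + b * Real.sqrt (d : ℝ) := by
    induction hx using IntermediateField.adjoin_induction with
    | mem y hy => rw [Set.mem_singleton_iff] at hy; exact ⟨0, 1, by simp [hy]⟩
    | algebraMap q => exact ⟨q, 0, by simp⟩
    | add y z _ _ hy hz =>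
      obtain ⟨a, b, rfl⟩ := hy
      obtain ⟨a', b', rfl⟩ := hz
      exact ⟨a + a', b + b', by push_cast; ring⟩
    | mul y z _ _ hy hz =>
      obtain ⟨a, b, rfl⟩ := hy
      obtain ⟨a', b', rfl⟩ := hz
      exact ⟨a * a' + d * b * b', a * b' + a' * b, by
        push_cast; linear_combination ((b : ℝ) * b') * hs⟩
    | inv y _ hy =>
      obtain ⟨a, b, rfl⟩ := hy
      by_cases hab : (a : ℝ) + b * Real.sqrt (d : ℝ) = 0
      · exact ⟨0, 0, by rw [hab]; simp⟩
      · have hirr := irrational_sqrt hd hsq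
        have hn : (a : ℝ) - b * Real.sqrt (d : ℝ) ≠ 0 := by
          intro h
          by_cases hb : b = 0
          · subst hb; simp at h hab; exact hab h
          · apply hirr
            refine ⟨a / b, ?_⟩
            have : (b : ℝ) ≠ 0 := by exact_mod_cast hb
            push_cast
            field_simp
            linarith
        have hN : (a : ℝ) ^ 2 - d * b ^ 2 ≠ 0 := by
          have := mul_ne_zero hab hn
          intro h
          apply this
          linear_combination h - (b : ℝ) ^ 2 * hs
        refine ⟨a / (a ^ 2 - d * b ^ 2), -b / (a ^ 2 - d * b ^ 2), ?_⟩
        push_cast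
        refine inv_eq_of_mul_eq_one_right ?_
        rw [div_mul_eq_mul_div, ← add_div, mul_div_assoc', div_eq_one_iff_eq hN]
        linear_combination -(b : ℝ) ^ 2 * hs
  obtain ⟨a, b, h⟩ := key
  exact ⟨a, b, Subtype.ext (by simpa [root] using h)⟩

theorem coords_eq_zero (hd : 1 < d) (hsq : Squarefree d) {a b : ℚ}
    (h : (a : realQuadraticField d) + b * root d = 0) : a = 0 ∧ b = 0 := by
  have h' : (a : ℝ) + b * Real.sqrt (d : ℝ) = 0 := by
    simpa [root] using congrArg Subtype.val h
  by_cases hb : b = 0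
  · subst hb; simp at h'; exact ⟨h', rfl⟩
  · exfalso
    apply irrational_sqrt hd hsq
    refine ⟨-a / b, ?_⟩
    have : (b : ℝ) ≠ 0 := by exact_mod_cast hb
    push_cast
    field_simp
    linarith

theorem coords_ext (hd : 1 < d) (hsq : Squarefree d) {a b a' b' : ℚ}
    (h : (a : realQuadraticField d) + b * root d = a' + b' * root d) : a = a' ∧ b = b' := by
  have := coords_eq_zero hd hsq (a := a - a') (b := b - b') (by push_cast; linear_combination h)
  constructor <;> linarith [this.1, this.2]

/-- The basis `1, √d` of `ℚ(√d)` over `ℚ`. -/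
noncomputable def ratBasis (hd : 1 < d) (hsq : Squarefree d) :
    Module.Basis (Fin 2) ℚ (realQuadraticField d) :=
  Module.Basis.mk (v := ![1, root d])
    (by
      rw [LinearIndependent.pair_iff]
      intro a b h
      exact coords_eq_zero hd hsq (by simpa [Algebra.smul_def] using h))
    (by
      rintro x -
      obtain ⟨a, b, rfl⟩ := exists_coords hd hsq x
      rw [Matrix.range_cons, Matrix.range_cons, Matrix.range_empty, Set.union_empty,
        Set.singleton_union, Submodule.mem_span_pair]
      exact ⟨a, b, by simp [Algebra.smul_def]⟩)

theorem finrank_eq_two (hd : 1 < d) (hsq : Squarefree d) :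
    Module.finrank ℚ (realQuadraticField d) = 2 := by
  rw [Module.finrank_eq_card_basis (ratBasis hd hsq)]; simp

theorem leftMulMatrix_coords (hd : 1 < d) (hsq : Squarefree d) (a b : ℚ) :
    Algebra.leftMulMatrix (ratBasis hd hsq) ((a : realQuadraticField d) + b * root d) =
      !![a, b * d; b, a] := by
  have hs := root_sq hd
  set B := ratBasis hd hsq with hB
  have h0 : B 0 = 1 := by simp [hB, ratBasis]
  have h1 : B 1 = root d := by simp [hB, ratBasis]
  have hr : ∀ u v : ℚ, B.repr ((u : realQuadraticField d) + v * root d) =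
      Finsupp.single 0 u + Finsupp.single 1 v := by
    intro u v
    have : (u : realQuadraticField d) + v * root d = u • B 0 + v • B 1 := by
      rw [h0, h1]; simp [Algebra.smul_def]
    rw [this]; simp
  ext i j
  rw [Algebra.leftMulMatrix_eq_repr_mul]
  fin_cases j
  · simp only [Fin.zero_eta, h0, mul_one, hr]
    fin_cases i <;> simp
  · have : ((a : realQuadraticField d) + b * root d) * root d =
        ((b * d : ℚ) : realQuadraticField d) + a * root d := by
      push_cast; linear_combination (b : realQuadraticField d) * hs
    simp only [Fin.mk_one, h1, this, hr]
    fin_cases i <;> simp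

theorem norm_coords (hd : 1 < d) (hsq : Squarefree d) (a b : ℚ) :
    Algebra.norm ℚ ((a : realQuadraticField d) + b * root d) = a ^ 2 - d * b ^ 2 := by
  rw [Algebra.norm_eq_matrix_det (ratBasis hd hsq), leftMulMatrix_coords, Matrix.det_fin_two_of]
  ring

theorem trace_coords (hd : 1 < d) (hsq : Squarefree d) (a b : ℚ) :
    Algebra.trace ℚ _ ((a : realQuadraticField d) + b * root d) = 2 * a := by
  rw [Algebra.trace_eq_matrix_trace (ratBasis hd hsq), leftMulMatrix_coords,
    Matrix.trace_fin_two_of]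
  ring

theorem isIntegral_root (hd : 1 < d) : IsIntegral ℤ (root d) := by
  refine IsIntegral.of_pow (n := 2) (by norm_num) ?_
  rw [root_sq hd]
  exact isIntegral_algebraMap (x := d)

/-- The element `√d` of the ring of integers of `ℚ(√d)`. -/
noncomputable def intRoot (hd : 1 < d) : 𝓞 (realQuadraticField d) :=
  ⟨root d, isIntegral_root hd⟩

theorem coe_intRoot (hd : 1 < d) : (intRoot hd : realQuadraticField d) = root d := rfl

theorem intRoot_sq (hd : 1 < d) : intRoot hd ^ 2 = (d : 𝓞 (realQuadraticField d)) := by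
  apply RingOfIntegers.coe_injective
  rw [map_pow, map_intCast]
  exact root_sq hd

theorem exists_int_of_mul_sq (hsq : Squarefree d) {w : ℚ} {k : ℤ}
    (h : d * w ^ 2 = k) : ∃ b : ℤ, w = b := by
  have h1 : d * w.num ^ 2 = k * (w.den : ℤ) ^ 2 := by
    have hw : w = w.num / w.den := (Rat.num_div_den w).symm
    have hden : (w.den : ℚ) ≠ 0 := by exact_mod_cast w.den_nz
    rw [hw] at h
    field_simp at h
    rw [mul_comm k]
    exact_mod_cast h
  have hcop : IsCoprime ((w.den : ℤ) ^ 2) (w.num ^ 2) := by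
    apply IsCoprime.pow
    rw [Int.isCoprime_iff_nat_coprime]
    exact w.reduced.symm
  have h2 : (w.den : ℤ) * w.den ∣ d := by
    rw [← sq]
    exact hcop.dvd_of_dvd_mul_right (Dvd.intro_left _ h1.symm)
  have h3 : w.den = 1 := by
    have := hsq _ h2
    simpa [Int.isUnit_iff] using this
  exact ⟨w.num, ((Rat.den_eq_one_iff w).mp h3).symm⟩

theorem two_mul_coords (hd : 1 < d) (hsq : Squarefree d) (x : 𝓞 (realQuadraticField d)) :
    ∃ a b : ℤ, 2 * (x : realQuadraticField d) = a + b * root d ∧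
      4 * Algebra.norm ℤ x = a ^ 2 - d * b ^ 2 ∧ Algebra.trace ℤ _ x = a := by
  obtain ⟨u, v, huv⟩ := exists_coords hd hsq (x : realQuadraticField d)
  have ht : ((Algebra.trace ℤ _ x : ℤ) : ℚ) = 2 * u := by
    rw [Algebra.coe_trace_int, huv, trace_coords hd hsq]
  have hn : ((Algebra.norm ℤ x : ℤ) : ℚ) = u ^ 2 - d * v ^ 2 := by
    rw [Algebra.coe_norm_int, huv, norm_coords hd hsq]
  obtain ⟨b, hb⟩ := exists_int_of_mul_sq hsq (w := 2 * v)
    (k := (Algebra.trace ℤ _ x) ^ 2 - 4 * Algebra.norm ℤ x) (by push_cast; rw [ht, hn]; ring)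
  refine ⟨Algebra.trace ℤ _ x, b, ?_, ?_, rfl⟩
  · have h1 : ((Algebra.trace ℤ _ x : ℤ) : realQuadraticField d) = ((2 * u : ℚ) : _) := by
      rw [← ht]; simp
    have h2 : (b : realQuadraticField d) = ((2 * v : ℚ) : _) := by
      rw [hb]; simp
    rw [h1, h2, huv]; push_cast; ring
  · have : (4 * Algebra.norm ℤ x : ℚ) = (Algebra.trace ℤ _ x) ^ 2 - d * b ^ 2 := by
      rw [hn, ht, ← hb]; ring
    exact_mod_cast this

theorem exists_of_coords (hd : 1 < d) {a b n : ℤ} (h : a ^ 2 - d * b ^ 2 = 4 * n) :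
    ∃ x : 𝓞 (realQuadraticField d), 2 * (x : realQuadraticField d) = a + b * root d := by
  have hs := root_sq hd
  have hx : IsIntegral ℤ (((a : realQuadraticField d) + b * root d) / 2) := by
    refine ⟨Polynomial.X ^ 2 - Polynomial.C a * Polynomial.X + Polynomial.C n, by monicity!, ?_⟩
    have h' : (a : realQuadraticField d) ^ 2 - d * b ^ 2 = 4 * n := by exact_mod_cast h
    simp only [Polynomial.eval₂_add, Polynomial.eval₂_sub, Polynomial.eval₂_mul,
      Polynomial.eval₂_pow, Polynomial.eval₂_X, Polynomial.eval₂_C]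
    simp only [eq_intCast]
    linear_combination -h' / 4 + (b : realQuadraticField d) ^ 2 / 4 * hs
  refine ⟨⟨_, hx⟩, ?_⟩
  show 2 * (((a : realQuadraticField d) + b * root d) / 2) = _
  ring

theorem exists_two_mul_eq (hd : 1 < d) (hsq : Squarefree d) (x : 𝓞 (realQuadraticField d)) :
    ∃ a b : ℤ, 2 * x = a + b * intRoot hd ∧
      4 * Algebra.norm ℤ x = a ^ 2 - d * b ^ 2 ∧ Algebra.trace ℤ _ x = a := by
  obtain ⟨a, b, h, h'⟩ := two_mul_coords hd hsq x
  refine ⟨a, b, ?_, h'⟩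
  apply RingOfIntegers.coe_injective
  rw [map_mul, map_add, map_mul, map_intCast, map_intCast, map_ofNat]
  exact h

theorem exists_eq_half (hd : 1 < d) {a b n : ℤ} (h : a ^ 2 - d * b ^ 2 = 4 * n) :
    ∃ x : 𝓞 (realQuadraticField d), 2 * x = a + b * intRoot hd := by
  obtain ⟨x, hx⟩ := exists_of_coords hd h
  refine ⟨x, ?_⟩
  apply RingOfIntegers.coe_injective
  rw [map_mul, map_add, map_mul, map_intCast, map_intCast, map_ofNat]
  exact hx

theorem int_coords_ext (hd : 1 < d) (hsq : Squarefree d) {a b a' b' : ℤ}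
    (h : (a + b * intRoot hd : 𝓞 (realQuadraticField d)) = a' + b' * intRoot hd) :
    a = a' ∧ b = b' := by
  have h1 := congrArg (fun x : 𝓞 (realQuadraticField d) ↦ (x : realQuadraticField d)) h
  have h2 := coords_ext hd hsq (a := a) (b := b) (a' := a') (b' := b')
    (by simpa [coe_intRoot] using h1)
  exact_mod_cast h2

theorem norm_int_coords (hd : 1 < d) (hsq : Squarefree d) (a b : ℤ) :
    Algebra.norm ℤ (a + b * intRoot hd : 𝓞 (realQuadraticField d)) = a ^ 2 - d * b ^ 2 := by
  have := norm_coords hd hsq a b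
  have h : ((Algebra.norm ℤ (a + b * intRoot hd : 𝓞 (realQuadraticField d)) : ℤ) : ℚ) =
      a ^ 2 - d * b ^ 2 := by
    rw [Algebra.coe_norm_int, ← this]
    simp [coe_intRoot]
  exact_mod_cast h

theorem trace_int_coords (hd : 1 < d) (hsq : Squarefree d) (a b : ℤ) :
    Algebra.trace ℤ _ (a + b * intRoot hd : 𝓞 (realQuadraticField d)) = 2 * a := by
  have := trace_coords hd hsq a b
  have h : ((Algebra.trace ℤ _ (a + b * intRoot hd : 𝓞 (realQuadraticField d)) : ℤ) : ℚ) =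
      2 * a := by
    rw [Algebra.coe_trace_int, ← this]
    simp [coe_intRoot]
  exact_mod_cast h

/-- Every integer of `ℚ(√d)` is a root of its characteristic polynomial. -/
theorem sq_sub_trace_mul_add_norm (hd : 1 < d) (hsq : Squarefree d)
    (x : 𝓞 (realQuadraticField d)) :
    x ^ 2 - (Algebra.trace ℤ _ x : ℤ) * x + (Algebra.norm ℤ x : ℤ) = 0 := by
  obtain ⟨a, b, h, hn, ht⟩ := exists_two_mul_eq hd hsq x
  have hs := intRoot_sq hd
  have hn' : (4 * (Algebra.norm ℤ x : ℤ) : 𝓞 (realQuadraticField d)) = a ^ 2 - d * b ^ 2 := by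
    exact_mod_cast congrArg (Int.cast (R := 𝓞 (realQuadraticField d))) hn
  have h4 : (4 : 𝓞 (realQuadraticField d)) ≠ 0 := by norm_num
  apply mul_left_cancel₀ h4
  rw [ht]
  linear_combination hn' + (2 * x - a + b * intRoot hd) * h +
    (b : 𝓞 (realQuadraticField d)) ^ 2 * hs

theorem squarefree_mod_four (hsq : Squarefree d) : d % 4 ≠ 0 := by
  intro h
  have := hsq 2 (by omega)
  simp [Int.isUnit_iff] at this

theorem sq_emod_four (a : ℤ) : a ^ 2 % 4 = a % 2 := by
  rcases Int.even_or_odd' a with ⟨k, rfl | rfl⟩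
  · ring_nf; omega
  · ring_nf; omega

theorem exists_eq_add_of_mod_four_ne_one (hd : 1 < d) (hsq : Squarefree d) (h4 : d % 4 ≠ 1)
    (x : 𝓞 (realQuadraticField d)) : ∃ a b : ℤ, x = a + b * intRoot hd := by
  obtain ⟨a, b, h, hn, -⟩ := exists_two_mul_eq hd hsq x
  have h0 := squarefree_mod_four hsq
  have key : a % 2 = 0 ∧ b % 2 = 0 := by
    have ha := sq_emod_four a
    have hb := sq_emod_four b
    have h1 : a ^ 2 % 4 = (d % 4 * (b ^ 2 % 4)) % 4 := by
      rw [← Int.mul_emod]; omega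
    rw [ha, hb] at h1
    have hb2 : b % 2 = 0 ∨ b % 2 = 1 := by omega
    have hd3 : d % 4 = 2 ∨ d % 4 = 3 := by omega
    rcases hb2 with hb2 | hb2 <;> rcases hd3 with hd3 | hd3 <;> rw [hb2, hd3] at h1 <;> omega
  obtain ⟨a', rfl⟩ : 2 ∣ a := by omega
  obtain ⟨b', rfl⟩ : 2 ∣ b := by omega
  refine ⟨a', b', mul_left_cancel₀ (two_ne_zero) (h.trans ?_)⟩
  push_cast; ring

theorem parity_of_mod_four_eq_one {a b n : ℤ} (h4 : d % 4 = 1) (hn : 4 * n = a ^ 2 - d * b ^ 2) :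
    a % 2 = b % 2 := by
  have ha := sq_emod_four a
  have hb := sq_emod_four b
  have h1 : a ^ 2 % 4 = (d % 4 * (b ^ 2 % 4)) % 4 := by
    rw [← Int.mul_emod]; omega
  rw [h4, ha, hb] at h1
  omega

theorem exists_half_one_add (hd : 1 < d) (h4 : d % 4 = 1) :
    ∃ w : 𝓞 (realQuadraticField d), 2 * w = 1 + intRoot hd := by
  obtain ⟨w, hw⟩ := exists_eq_half hd (a := 1) (b := 1) (n := (1 - d) / 4) (by omega)
  exact ⟨w, by simpa using hw⟩

theorem discr_of_mod_four_ne_one (hd : 1 < d) (hsq : Squarefree d) (h4 : d % 4 ≠ 1) :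
    discr (realQuadraticField d) = 4 * d := by
  have hs := intRoot_sq hd
  let B : Module.Basis (Fin 2) ℤ (𝓞 (realQuadraticField d)) :=
    Module.Basis.mk (v := ![1, intRoot hd])
      (by
        rw [LinearIndependent.pair_iff]
        intro a b h
        exact int_coords_ext hd hsq (a' := 0) (b' := 0) (by simpa using h))
      (by
        rintro x -
        obtain ⟨a, b, rfl⟩ := exists_eq_add_of_mod_four_ne_one hd hsq h4 x
        rw [Matrix.range_cons, Matrix.range_cons, Matrix.range_empty, Set.union_empty,
          Set.singleton_union, Submodule.mem_span_pair]
        exact ⟨a, b, by simp⟩)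
  have h0 : B 0 = 1 := by simp [B]
  have h1 : B 1 = intRoot hd := by simp [B]
  have t1 := trace_int_coords hd hsq 1 0
  have t2 := trace_int_coords hd hsq 0 1
  have t3 := trace_int_coords hd hsq d 0
  rw [← discr_eq_discr _ B, Algebra.discr_def, Matrix.det_fin_two]
  simp only [Algebra.traceMatrix_apply, Algebra.traceForm_apply, h0, h1, mul_one, one_mul]
  rw [← sq, hs]
  simp only [Int.cast_one, Int.cast_zero, zero_mul, add_zero, one_mul, zero_add] at t1 t2 t3
  rw [t1, t2, t3]; ring

theorem discr_of_mod_four_eq_one (hd : 1 < d) (hsq : Squarefree d) (h4 : d % 4 = 1) :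
    discr (realQuadraticField d) = d := by
  have hs := intRoot_sq hd
  obtain ⟨w, hw⟩ := exists_half_one_add hd h4
  let B : Module.Basis (Fin 2) ℤ (𝓞 (realQuadraticField d)) :=
    Module.Basis.mk (v := ![1, w])
      (by
        rw [LinearIndependent.pair_iff]
        intro a b h
        have := int_coords_ext hd hsq (a := 2 * a + b) (b := b) (a' := 0) (b' := 0) (by
          simp only [zsmul_eq_mul, mul_one] at h
          push_cast
          linear_combination 2 * h - (b : 𝓞 (realQuadraticField d)) * hw)
        omega)
      (by
        rintro x -
        obtain ⟨a, b, h, hn, -⟩ := exists_two_mul_eq hd hsq x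
        have := parity_of_mod_four_eq_one h4 hn
        obtain ⟨c, rfl⟩ : ∃ c, a = b + 2 * c := ⟨(a - b) / 2, by omega⟩
        rw [Matrix.range_cons, Matrix.range_cons, Matrix.range_empty, Set.union_empty,
          Set.singleton_union, Submodule.mem_span_pair]
        refine ⟨c, b, mul_left_cancel₀ (two_ne_zero) ?_⟩
        simp only [zsmul_eq_mul, mul_one]
        push_cast at h
        linear_combination (b : 𝓞 (realQuadraticField d)) * hw - h)
  have h0 : B 0 = 1 := by simp [B]
  have h1 : B 1 = w := by simp [B]
  have t1 : Algebra.trace ℤ _ (1 : 𝓞 (realQuadraticField d)) = 2 := by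
    simpa using trace_int_coords hd hsq 1 0
  have t2 : Algebra.trace ℤ _ w = 1 := by
    have := trace_int_coords hd hsq 1 1
    simp only [Int.cast_one, one_mul, ← hw, two_mul, map_add] at this
    omega
  have t3 : Algebra.trace ℤ _ (w * w) = (d + 1) / 2 := by
    have := trace_int_coords hd hsq (1 + d) 2
    have h' : (((1 + d : ℤ) : 𝓞 (realQuadraticField d)) + ((2 : ℤ) : 𝓞 (realQuadraticField d)) *
        intRoot hd) = (4 : ℤ) • (w * w) := by
      simp only [zsmul_eq_mul]
      push_cast
      linear_combination -(2 * w + 1 + intRoot hd) * hw - hs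
    rw [h', map_zsmul, smul_eq_mul] at this
    omega
  rw [← discr_eq_discr _ B, Algebra.discr_def, Matrix.det_fin_two]
  simp only [Algebra.traceMatrix_apply, Algebra.traceForm_apply, h0, h1, mul_one, one_mul]
  rw [t1, t2, t3]; omega

theorem odd_classNumber_iff (K : Type*) [Field K] [NumberField K] :
    Odd (classNumber K) ↔
      ∀ I : Ideal (𝓞 K), I ≠ ⊥ → (I ^ 2).IsPrincipal → I.IsPrincipal := by
  rw [classNumber]
  constructor
  · rintro ⟨k, hk⟩ I hI h2
    have hI0 : I ∈ nonZeroDivisors (Ideal (𝓞 K)) := mem_nonZeroDivisors_of_ne_zero hI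
    rw [← ClassGroup.mk0_eq_one_iff (pow_mem hI0 2)] at h2
    rw [← ClassGroup.mk0_eq_one_iff hI0]
    have h3 : ClassGroup.mk0 ⟨I, hI0⟩ ^ 2 = 1 := by
      rw [← map_pow]; exact h2
    have h4 := pow_card_eq_one (x := ClassGroup.mk0 ⟨I, hI0⟩)
    rwa [hk, pow_succ, pow_mul, h3, one_pow, one_mul] at h4
  · intro h
    by_contra hodd
    rw [Nat.not_odd_iff_even, even_iff_two_dvd] at hodd
    have : Fact (Nat.Prime 2) := ⟨Nat.prime_two⟩
    obtain ⟨c, hc⟩ := exists_prime_orderOf_dvd_card 2 hodd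
    obtain ⟨⟨I, hI0⟩, rfl⟩ := ClassGroup.mk0_surjective c
    have hI : I ≠ ⊥ := nonZeroDivisors.ne_zero hI0
    have h2 : (I ^ 2).IsPrincipal := by
      rw [← ClassGroup.mk0_eq_one_iff (pow_mem hI0 2)]
      have := pow_orderOf_eq_one (ClassGroup.mk0 ⟨I, hI0⟩)
      rw [hc, ← map_pow] at this
      exact this
    have h1 := (ClassGroup.mk0_eq_one_iff hI0).mpr (h I hI h2)
    rw [h1, orderOf_one] at hc
    norm_num at hc

section Dedekind

variable {R : Type*} [CommRing R] [IsDedekindDomain R]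

theorem isPrincipal_of_mul_span {I : Ideal R} {β δ : R} (hβ : β ≠ 0)
    (h : I * Ideal.span {β} = Ideal.span {δ}) : I.IsPrincipal := by
  have hdvd : Ideal.span {β} ∣ Ideal.span {δ} := Dvd.intro_left _ h
  rw [Ideal.dvd_span_singleton, Ideal.mem_span_singleton] at hdvd
  obtain ⟨x, rfl⟩ := hdvd
  have hb : Ideal.span {β} ≠ (0 : Ideal R) := by
    simpa [Ideal.zero_eq_bot, Ideal.span_singleton_eq_bot] using hβ
  refine ⟨x, ?_⟩
  rw [mul_comm, ← Ideal.span_singleton_mul_span_singleton] at h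
  exact mul_left_cancel₀ hb h

end Dedekind

/-- A squarefree integer that generates the square of an ideal is a product of primes dividing the
discriminant. -/
theorem dvd_discr_of_sq_eq_span {K : Type*} [Field K] [NumberField K] {Z : Ideal (𝓞 K)} {a l : ℕ}
    (ha : Squarefree a) (hl : l.Prime) (hla : l ∣ a) (hZ : Z ^ 2 = Ideal.span {(a : 𝓞 K)}) :
    (l : ℤ) ∣ discr K := by
  by_contra hdisc
  have hlp : Prime (l : ℤ) := Nat.prime_iff_prime_int.mp hl
  have hunr := (not_dvd_discr_iff_isUnramifiedIn K (𝓞 K) hlp).mp hdisc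
  obtain ⟨c, rfl⟩ := hla
  have hlc : ¬ l ∣ c := by
    rintro ⟨e, rfl⟩
    have := ha l ⟨e, by ring⟩
    exact hl.one_lt.ne' (Nat.isUnit_iff.mp this)
  have hmax : (Ideal.span {(l : ℤ)}).IsMaximal :=
    PrincipalIdealRing.isMaximal_of_irreducible hlp.irreducible
  obtain ⟨P, hPm, hPl⟩ := Ideal.exists_maximal_ideal_liesOver_of_isIntegral (S := 𝓞 K)
    (Ideal.span {(l : ℤ)})
  have hPp : P.IsPrime := hPm.isPrime
  have hmap : (Ideal.span {(l : ℤ)}).map (algebraMap ℤ (𝓞 K)) = Ideal.span {(l : 𝓞 K)} := by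
    rw [Ideal.map_span]; simp
  have hne : Ideal.span {(l : 𝓞 K)} ≠ ⊥ := by
    simp [hl.ne_zero]
  have he := hunr.ramificationIdx_eq_one hPl
  rw [Ideal.IsDedekindDomain.ramificationIdx_eq_multiplicity (Ideal.span {(l : ℤ)}) P
    (by rw [hmap]; exact hne), hmap] at he
  have hlP : (l : 𝓞 K) ∈ P := by
    have : (l : ℤ) ∈ P.under ℤ := by
      rw [← hPl.over]; exact Ideal.mem_span_singleton_self _
    simpa [Ideal.mem_comap] using this
  have hP0 : P ≠ ⊥ := by
    rintro rfl
    simp [hl.ne_zero] at hlP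
  have hPprime : Prime P := Ideal.prime_of_isPrime hP0 hPp
  have hcP : (c : 𝓞 K) ∉ P := by
    intro hc
    have hcop : IsCoprime (l : ℤ) (c : ℤ) :=
      Nat.isCoprime_iff_coprime.mpr ((Nat.Prime.coprime_iff_not_dvd hl).mpr hlc)
    obtain ⟨u, v, huv⟩ := hcop
    apply hPp.ne_top
    rw [Ideal.eq_top_iff_one]
    have : (1 : 𝓞 K) = u * l + v * c := by exact_mod_cast congrArg (Int.cast (R := 𝓞 K)) huv.symm
    rw [this]
    exact P.add_mem (P.mul_mem_left _ hlP) (P.mul_mem_left _ hc)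
  have hPZ : P ∣ Z := by
    apply hPprime.dvd_of_dvd_pow (n := 2)
    rw [hZ, Ideal.dvd_span_singleton]
    push_cast
    exact P.mul_mem_right _ hlP
  have hP2 : P ^ 2 ∣ Ideal.span {(l : 𝓞 K)} * Ideal.span {(c : 𝓞 K)} := by
    rw [Ideal.span_singleton_mul_span_singleton]
    have := pow_dvd_pow_of_dvd hPZ 2
    rw [hZ] at this
    exact_mod_cast this
  have hP2l : P ^ 2 ∣ Ideal.span {(l : 𝓞 K)} := by
    refine hPprime.pow_dvd_of_dvd_mul_right 2 ?_ hP2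
    rwa [Ideal.dvd_span_singleton]
  have hfin : FiniteMultiplicity P (Ideal.span {(l : 𝓞 K)}) :=
    FiniteMultiplicity.of_prime_left hPprime hne
  have := hfin.le_multiplicity_of_pow_dvd hP2l
  omega

theorem exists_sq_mul_squarefree {m : ℤ} (hm : m ≠ 0) :
    ∃ a k : ℕ, Squarefree a ∧ k ≠ 0 ∧ (m = k ^ 2 * a ∨ m = -(k ^ 2 * a)) := by
  obtain ⟨a, k, h, ha⟩ := Nat.sq_mul_squarefree m.natAbs
  refine ⟨a, k, ha, ?_, ?_⟩
  · rintro rfl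
    simp at h
    exact hm (Int.natAbs_eq_zero.mp h.symm)
  · have : (m.natAbs : ℤ) = k ^ 2 * a := by rw [← h]; push_cast; ring
    omega

/-- An ideal whose square is generated by an element of square norm becomes, after multiplication by
an ideal with square generated by a squarefree integer, principal up to an integer factor. -/
theorem exists_mul_eq_span_of_sq_eq_span (hd : 1 < d) (hsq : Squarefree d)
    {I : Ideal (𝓞 (realQuadraticField d))} (hI : I ≠ ⊥) {γ : 𝓞 (realQuadraticField d)}
    (hγ : I ^ 2 = Ideal.span {γ}) {n : ℤ} (hn : Algebra.norm ℤ γ = n ^ 2) :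
    ∃ (Z : Ideal (𝓞 (realQuadraticField d))) (δ : 𝓞 (realQuadraticField d)) (a k : ℕ),
      Squarefree a ∧ k ≠ 0 ∧
      Z ^ 2 = Ideal.span {(a : 𝓞 (realQuadraticField d))} ∧
      I * (Ideal.span {(k : 𝓞 (realQuadraticField d))} * Z) = Ideal.span {δ} := by
  have hγ0 : γ ≠ 0 := by
    rintro rfl
    apply hI
    have : I ^ 2 = 0 := by rw [hγ]; simp
    exact pow_eq_zero_iff two_ne_zero |>.mp this
  have hn0 : n ≠ 0 := by
    rintro rfl
    apply hγ0
    rw [← Algebra.norm_eq_zero_iff (R := ℤ), hn]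
    norm_num
  have key : ∃ (δ : 𝓞 (realQuadraticField d)) (m : ℤ), m ≠ 0 ∧
      Ideal.span {δ} ^ 2 = I ^ 2 * Ideal.span {(m : 𝓞 (realQuadraticField d))} := by
    have hch := sq_sub_trace_mul_add_norm hd hsq γ
    rw [hn] at hch
    set t := Algebra.trace ℤ _ γ with ht
    have h1 : (γ + n) ^ 2 = γ * ((t + 2 * n : ℤ) : 𝓞 (realQuadraticField d)) := by
      push_cast at hch ⊢
      linear_combination hch
    by_cases hm : t + 2 * n = 0
    · rw [hm, Int.cast_zero, mul_zero, pow_eq_zero_iff two_ne_zero] at h1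
      refine ⟨n, -n, by simpa using hn0, ?_⟩
      rw [hγ, Ideal.span_singleton_pow, Ideal.span_singleton_mul_span_singleton]
      congr 2
      push_cast
      linear_combination (n : 𝓞 (realQuadraticField d)) * h1
    · refine ⟨γ + n, _, hm, ?_⟩
      rw [hγ, Ideal.span_singleton_pow, Ideal.span_singleton_mul_span_singleton, h1]
  obtain ⟨δ, m, hm, h⟩ := key
  obtain ⟨a, k, ha, hk, hmk⟩ := exists_sq_mul_squarefree hm
  have hspan : Ideal.span {(m : 𝓞 (realQuadraticField d))} =
      Ideal.span {(k : 𝓞 (realQuadraticField d))} ^ 2 *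
        Ideal.span {(a : 𝓞 (realQuadraticField d))} := by
    rw [Ideal.span_singleton_pow, Ideal.span_singleton_mul_span_singleton]
    rcases hmk with rfl | rfl
    · push_cast; rfl
    · push_cast; exact Ideal.span_singleton_neg _
  have hdvd : I * Ideal.span {(k : 𝓞 (realQuadraticField d))} ∣ Ideal.span {δ} := by
    rw [← UniqueFactorizationMonoid.pow_dvd_pow_iff_dvd two_ne_zero, h, hspan, mul_pow, ← mul_assoc]
    exact dvd_mul_right _ _
  obtain ⟨Z, hZ⟩ := hdvd
  refine ⟨Z, δ, a, k, ha, hk, ?_, by rw [hZ, mul_assoc]⟩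
  rw [hZ, hspan, mul_pow, mul_pow, ← mul_assoc] at h
  refine mul_left_cancel₀ (mul_ne_zero (pow_ne_zero _ hI) (pow_ne_zero 2 ?_)) h
  simpa [Ideal.zero_eq_bot, Ideal.span_singleton_eq_bot] using hk

/-- The integer `a` is, up to a unit, the square of an element. -/
def IsSqUpToUnit (d : ℤ) (a : ℕ) : Prop :=
  ∃ β : 𝓞 (realQuadraticField d), Associated (β ^ 2) (a : 𝓞 (realQuadraticField d))

theorem IsSqUpToUnit.mul {a b : ℕ} (ha : IsSqUpToUnit d a) (hb : IsSqUpToUnit d b) :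
    IsSqUpToUnit d (a * b) := by
  obtain ⟨β, hβ⟩ := ha
  obtain ⟨γ, hγ⟩ := hb
  exact ⟨β * γ, by rw [mul_pow]; push_cast; exact hβ.mul_mul hγ⟩

theorem isSqUpToUnit_of_primes {a : ℕ} (ha : a ≠ 0)
    (h : ∀ l : ℕ, l.Prime → l ∣ a → IsSqUpToUnit d l) : IsSqUpToUnit d a := by
  induction a using Nat.recOnMul with
  | zero => exact absurd rfl ha
  | one => exact ⟨1, by simp⟩
  | prime p hp => exact h p hp dvd_rfl
  | mul a b iha ihb =>
    rw [mul_ne_zero_iff] at ha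
    exact (iha ha.1 fun l hl hla ↦ h l hl (hla.mul_right _)).mul
      (ihb ha.2 fun l hl hla ↦ h l hl (hla.mul_left _))

theorem natAbs_norm_of_sq_eq_span {I : Ideal (𝓞 (realQuadraticField d))}
    {γ : 𝓞 (realQuadraticField d)} (hγ : I ^ 2 = Ideal.span {γ}) :
    Algebra.norm ℤ γ = (Ideal.absNorm I : ℤ) ^ 2 ∨
      Algebra.norm ℤ γ = -(Ideal.absNorm I : ℤ) ^ 2 := by
  have h := congrArg Ideal.absNorm hγ
  rw [map_pow, Ideal.absNorm_span_singleton] at h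
  have h' : ((Algebra.norm ℤ γ).natAbs : ℤ) = (Ideal.absNorm I : ℤ) ^ 2 := by
    rw [← h]; push_cast; rfl
  omega

/-- If every ramified prime is the square of an element up to a unit, and `-1` is the norm of a unit
as soon as it is the norm of an element of the field, then the class number is odd. -/
theorem odd_classNumber_of (hd : 1 < d) (hsq : Squarefree d)
    (hram : ∀ l : ℕ, l.Prime → (l : ℤ) ∣ discr (realQuadraticField d) → IsSqUpToUnit d l)
    (hneg : ∀ (γ : 𝓞 (realQuadraticField d)) (n : ℤ), n ≠ 0 → Algebra.norm ℤ γ = -n ^ 2 →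
      ∃ η : (𝓞 (realQuadraticField d))ˣ, Algebra.norm ℤ (η : 𝓞 (realQuadraticField d)) = -1) :
    Odd (classNumber (realQuadraticField d)) := by
  rw [odd_classNumber_iff]
  rintro I hI ⟨γ, hγ⟩
  replace hγ : I ^ 2 = Ideal.span {γ} := hγ
  obtain ⟨γ', hγ', hn⟩ : ∃ γ', I ^ 2 = Ideal.span {γ'} ∧
      Algebra.norm ℤ γ' = (Ideal.absNorm I : ℤ) ^ 2 := by
    rcases natAbs_norm_of_sq_eq_span hγ with h | h
    · exact ⟨γ, hγ, h⟩
    · have hI0 : (Ideal.absNorm I : ℤ) ≠ 0 := by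
        exact_mod_cast (Ideal.absNorm_eq_zero_iff).not.mpr hI
      obtain ⟨η, hη⟩ := hneg γ _ hI0 h
      refine ⟨γ * η, ?_, by rw [map_mul, h, hη]; ring⟩
      rw [hγ, Ideal.span_singleton_mul_right_unit η.isUnit]
  obtain ⟨Z, δ, a, k, ha, hk, hZ, hIZ⟩ := exists_mul_eq_span_of_sq_eq_span hd hsq hI hγ' hn
  obtain ⟨β, hβ⟩ := isSqUpToUnit_of_primes (d := d) ha.ne_zero
    fun l hl hla ↦ hram l hl (dvd_discr_of_sq_eq_span ha hl hla hZ)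
  have hZβ : Z = Ideal.span {β} := by
    apply pow_left_injective two_ne_zero
    show Z ^ 2 = Ideal.span {β} ^ 2
    rw [hZ, Ideal.span_singleton_pow, Ideal.span_singleton_eq_span_singleton]
    exact hβ.symm
  have hβ0 : β ≠ 0 := by
    rintro rfl
    have : (a : 𝓞 (realQuadraticField d)) = 0 := by simpa [Associated.comm] using hβ
    exact ha.ne_zero (by exact_mod_cast this)
  rw [hZβ, Ideal.span_singleton_mul_span_singleton] at hIZ
  exact isPrincipal_of_mul_span (mul_ne_zero (by exact_mod_cast hk) hβ0) hIZ

theorem exists_split_of_coprime_mul {D u v y : ℕ} (hD : 0 < D) (huv : u.Coprime v)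
    (h : u * v = D * y ^ 2) :
    ∃ m n a b : ℕ, m * n = D ∧ u = m * a ^ 2 ∧ v = n * b ^ 2 := by
  have hmn : D.gcd u * D.gcd v = D := by
    rw [← Nat.Coprime.gcd_mul D huv, h]; simp
  obtain ⟨u', hu⟩ := Nat.gcd_dvd_right D u
  obtain ⟨v', hv⟩ := Nat.gcd_dvd_right D v
  set m := D.gcd u
  set n := D.gcd v
  have hy : u' * v' = y ^ 2 := by
    apply Nat.eq_of_mul_eq_mul_left hD
    rw [← h, hu, hv, ← hmn]; ring
  have hcop : u'.Coprime v' :=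
    Nat.Coprime.coprime_dvd_left ⟨m, by rw [hu]; ring⟩
      (Nat.Coprime.coprime_dvd_right ⟨n, by rw [hv]; ring⟩ huv)
  obtain ⟨a, ha⟩ := exists_eq_pow_of_mul_eq_pow (Nat.isUnit_iff.mpr hcop) hy
  obtain ⟨b, hb⟩ := exists_eq_pow_of_mul_eq_pow (Nat.isUnit_iff.mpr hcop.symm)
    ((mul_comm _ _).trans hy)
  exact ⟨m, n, a, b, hmn, by rw [hu, ha], by rw [hv, hb]⟩

/-- Splitting `(x + 1) * (x - 1) = d * y ^ 2` for the fundamental solution of the Pell equation. -/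
theorem pell_split (hd : 1 < d) (hsq : Squarefree d) :
    ∃ m n a b : ℕ, (m * n : ℤ) = d ∧
      ((m ≠ 1 ∧ (m * a ^ 2 - n * b ^ 2 : ℤ) = 1) ∨
        (d % 4 = 3 ∧ (m * a ^ 2 - n * b ^ 2 : ℤ) = 2)) := by
  have hns : ¬ IsSquare d := by
    rintro ⟨r, rfl⟩
    rcases Int.isUnit_iff.mp (hsq r dvd_rfl) with rfl | rfl <;> simp at hd
  obtain ⟨s, hs1, hs2, hs3⟩ := Pell.IsFundamental.exists_of_not_isSquare (by omega) hns
  have hprop := s.prop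
  obtain ⟨X, hX⟩ := Int.eq_ofNat_of_zero_le (show 0 ≤ s.x by omega)
  obtain ⟨Y, hY⟩ := Int.eq_ofNat_of_zero_le (show 0 ≤ s.y by omega)
  obtain ⟨D, rfl⟩ := Int.eq_ofNat_of_zero_le (show 0 ≤ d by omega)
  rw [hX, hY] at hprop
  have hX1 : 1 < X := by omega
  rcases Nat.even_or_odd' X with ⟨t, rfl | rfl⟩
  · have hmod : D % 4 = 3 := by
      have h1 : (D : ℤ) * Y ^ 2 % 4 = 3 := by
        have : (D : ℤ) * Y ^ 2 = 4 * t ^ 2 - 1 := by push_cast at hprop; linarith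
        rw [this]; omega
      have hY2 := sq_emod_four Y
      rw [Int.mul_emod, hY2] at h1
      have : (Y : ℤ) % 2 = 0 ∨ (Y : ℤ) % 2 = 1 := by omega
      rcases this with h | h <;> rw [h] at h1 <;> omega
    have hcop : (2 * t + 1).Coprime (2 * t - 1) := by
      have h2 : 2 * t + 1 = (2 * t - 1) + 2 := by omega
      rw [h2, Nat.coprime_self_add_left, Nat.coprime_two_left]
      exact ⟨t - 1, by omega⟩
    obtain ⟨m, n, a, b, hmn, hu, hv⟩ := exists_split_of_coprime_mul (D := D) (y := Y)
      (by omega) hcop (by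
      zify [show 1 ≤ 2 * t by omega]
      push_cast at hprop
      linarith)
    refine ⟨m, n, a, b, by exact_mod_cast hmn, Or.inr ⟨by omega, ?_⟩⟩
    have hu' : ((2 * t + 1 : ℕ) : ℤ) = m * a ^ 2 := by exact_mod_cast hu
    have hv' : ((2 * t - 1 : ℕ) : ℤ) = n * b ^ 2 := by exact_mod_cast hv
    omega
  · have hY2 : Y % 2 = 0 := by
      have h1 : (D : ℤ) * Y ^ 2 = 4 * (t ^ 2 + t) := by push_cast at hprop; linarith
      by_contra hodd
      have h3 : (Y : ℤ) ^ 2 % 4 = 1 := by rw [sq_emod_four]; omega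
      have h4 : (D : ℤ) * Y ^ 2 % 4 = 0 := by rw [h1]; omega
      rw [Int.mul_emod, h3] at h4
      have := squarefree_mod_four hsq
      omega
    obtain ⟨Z, rfl⟩ : ∃ Z, Y = 2 * Z := ⟨Y / 2, by omega⟩
    have hcop : (t + 1).Coprime t := by simp
    obtain ⟨m, n, a, b, hmn, hu, hv⟩ := exists_split_of_coprime_mul (D := D) (y := Z)
      (by omega) hcop (by
      zify
      push_cast at hprop
      linarith)
    have hu' : (t + 1 : ℤ) = m * a ^ 2 := by exact_mod_cast hu
    have hv' : (t : ℤ) = n * b ^ 2 := by exact_mod_cast hv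
    refine ⟨m, n, a, b, by exact_mod_cast hmn, Or.inl ⟨?_, by omega⟩⟩
    rintro rfl
    rw [one_mul] at hmn hu
    subst hmn
    have ha1 : 1 < a := by
      by_contra h
      have : a ^ 2 ≤ 1 := pow_le_one₀ (by omega) (by omega)
      omega
    have := hs3 (b := Pell.Solution₁.mk a b (by push_cast at hu' ⊢; linarith)) (by simpa using ha1)
    rw [hX, Pell.Solution₁.x_mk] at this
    have h5 : 2 * t + 1 ≤ a := by exact_mod_cast this
    nlinarith

theorem isSqUpToUnit_of_split (hd : 1 < d) {m n : ℕ} {a b e : ℤ} (hmn : (m * n : ℤ) = d)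
    (he : e ^ 2 = 1) (h : m * a ^ 2 - n * b ^ 2 = e) : IsSqUpToUnit d m := by
  have hs := intRoot_sq hd
  set s := intRoot hd
  have hmn' : (m * n : 𝓞 (realQuadraticField d)) = d := by
    exact_mod_cast congrArg (Int.cast (R := 𝓞 (realQuadraticField d))) hmn
  have h' : ((m * a ^ 2 - n * b ^ 2) ^ 2 : 𝓞 (realQuadraticField d)) = 1 := by
    rw [← h] at he
    exact_mod_cast congrArg (Int.cast (R := 𝓞 (realQuadraticField d))) he
  let w : (𝓞 (realQuadraticField d))ˣ := Units.mkOfMulEqOne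
    (m * a ^ 2 + n * b ^ 2 + 2 * a * b * s) (m * a ^ 2 + n * b ^ 2 - 2 * a * b * s) (by
      linear_combination h' - 4 * a ^ 2 * b ^ 2 * hs + 4 * a ^ 2 * b ^ 2 * hmn')
  refine ⟨m * a + b * s, Associated.symm ⟨w, ?_⟩⟩
  show (m : 𝓞 (realQuadraticField d)) * (m * a ^ 2 + n * b ^ 2 + 2 * a * b * s) = _
  linear_combination -(b : 𝓞 (realQuadraticField d)) ^ 2 * hs + b ^ 2 * hmn'

theorem isSqUpToUnit_two (hd : 1 < d) {a b e : ℤ} (he : e ^ 2 = 1)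
    (h : a ^ 2 - d * b ^ 2 = 2 * e) : IsSqUpToUnit d 2 := by
  have hs := intRoot_sq hd
  set s := intRoot hd
  have h' : (a ^ 2 - d * b ^ 2 : 𝓞 (realQuadraticField d)) = 2 * e := by
    exact_mod_cast congrArg (Int.cast (R := 𝓞 (realQuadraticField d))) h
  have he' : (e ^ 2 : 𝓞 (realQuadraticField d)) = 1 := by
    exact_mod_cast congrArg (Int.cast (R := 𝓞 (realQuadraticField d))) he
  let w : (𝓞 (realQuadraticField d))ˣ := Units.mkOfMulEqOne
    (a ^ 2 - e + a * b * s) (a ^ 2 - e - a * b * s) (by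
      linear_combination he' + a ^ 2 * h' - a ^ 2 * b ^ 2 * hs)
  refine ⟨a + b * s, Associated.symm ⟨w, ?_⟩⟩
  show ((2 : ℕ) : 𝓞 (realQuadraticField d)) * (a ^ 2 - e + a * b * s) = _
  push_cast
  linear_combination h' - b ^ 2 * hs

theorem isSqUpToUnit_self (hd : 1 < d) {m : ℕ} (hm : (m : ℤ) = d) : IsSqUpToUnit d m := by
  refine ⟨intRoot hd, ?_⟩
  rw [intRoot_sq hd, ← hm]
  simp

theorem exists_unit_norm_neg_one (hd : 1 < d) (hsq : Squarefree d) {a b : ℤ}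
    (h : b ^ 2 - d * a ^ 2 = -1) :
    ∃ η : (𝓞 (realQuadraticField d))ˣ, Algebra.norm ℤ (η : 𝓞 (realQuadraticField d)) = -1 := by
  have hs := intRoot_sq hd
  have h' : (b ^ 2 - d * a ^ 2 : 𝓞 (realQuadraticField d)) = -1 := by
    exact_mod_cast congrArg (Int.cast (R := 𝓞 (realQuadraticField d))) h
  refine ⟨Units.mkOfMulEqOne (b + a * intRoot hd) (-(b - a * intRoot hd)) (by
    linear_combination -h' + a ^ 2 * hs), ?_⟩
  show Algebra.norm ℤ (b + a * intRoot hd : 𝓞 (realQuadraticField d)) = -1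
  rw [norm_int_coords hd hsq, h]

/-- A squarefree integer with a prime factor `p ≡ 3 (mod 4)` is not, even up to squares, a sum of
two squares. -/
theorem eq_zero_of_sq_add_sq_eq (hd : 1 < d) (hsq : Squarefree d) {p : ℕ} (hp : p.Prime)
    (hp4 : p % 4 = 3) (hpd : (p : ℤ) ∣ d) {a b c : ℤ} (h : a ^ 2 + c ^ 2 = d * b ^ 2) : c = 0 := by
  by_cases hb : b = 0
  · subst hb
    nlinarith [sq_nonneg a, sq_nonneg c]
  exfalso
  have : Fact p.Prime := ⟨hp⟩
  obtain ⟨D, rfl⟩ := Int.eq_ofNat_of_zero_le (show 0 ≤ d by omega)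
  have hpD : p ∣ D := by exact_mod_cast hpd
  have hDsq : Squarefree D := by simpa using (Int.squarefree_natAbs.mpr hsq)
  have hn : D * b.natAbs ^ 2 = a.natAbs ^ 2 + c.natAbs ^ 2 := by
    zify; simp only [sq_abs]; linarith
  have hbn : b.natAbs ≠ 0 := by simpa using hb
  have hD0 : D ≠ 0 := hDsq.ne_zero
  have hv : padicValNat p D = 1 := by
    have h1 := one_le_padicValNat_of_dvd hD0 hpD
    have h2 := hDsq.natFactorization_le_one p
    rw [Nat.factorization_def _ hp] at h2
    omega
  have := Nat.eq_sq_add_sq_iff.mp ⟨_, _, hn⟩ p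
    (Nat.mem_primeFactors.mpr ⟨hp, hpD.mul_right _, mul_ne_zero hD0 (pow_ne_zero 2 hbn)⟩) hp4
  rw [padicValNat.mul hD0 (pow_ne_zero 2 hbn), padicValNat.pow, hv] at this
  rw [Nat.even_iff] at this
  omega

theorem not_norm_neg_sq (hd : 1 < d) (hsq : Squarefree d) {p : ℕ} (hp : p.Prime)
    (hp4 : p % 4 = 3) (hpd : (p : ℤ) ∣ d) {γ : 𝓞 (realQuadraticField d)} {n : ℤ} (hn : n ≠ 0) :
    Algebra.norm ℤ γ ≠ -n ^ 2 := by
  intro h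
  obtain ⟨a, b, -, hN, -⟩ := exists_two_mul_eq hd hsq γ
  have := eq_zero_of_sq_add_sq_eq hd hsq hp hp4 hpd (a := a) (b := b) (c := 2 * n) (by
    rw [h] at hN; linarith)
  omega

theorem prime_dvd_discr (hd : 1 < d) (hsq : Squarefree d) {l : ℕ} (hl : l.Prime)
    (h : (l : ℤ) ∣ discr (realQuadraticField d)) :
    (l : ℤ) ∣ d ∨ (d % 4 ≠ 1 ∧ l = 2) := by
  by_cases h4 : d % 4 = 1
  · left; rwa [discr_of_mod_four_eq_one hd hsq h4] at h
  · rw [discr_of_mod_four_ne_one hd hsq h4] at h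
    rcases (Nat.prime_iff_prime_int.mp hl).dvd_or_dvd h with h | h
    · right
      refine ⟨h4, ?_⟩
      have h2 : l ∣ 2 ^ 2 := by exact_mod_cast h
      exact (Nat.prime_dvd_prime_iff_eq hl Nat.prime_two).mp (hl.dvd_of_dvd_pow h2)
    · left; exact h

theorem dvd_discr_of_dvd (hd : 1 < d) (hsq : Squarefree d) {l : ℤ} (h : l ∣ d) :
    l ∣ discr (realQuadraticField d) := by
  by_cases h4 : d % 4 = 1
  · rwa [discr_of_mod_four_eq_one hd hsq h4]
  · rw [discr_of_mod_four_ne_one hd hsq h4]; exact h.mul_left _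

theorem odd_classNumber_of_prime {p : ℕ} (hp : p.Prime) (h4 : p % 4 ≠ 3) :
    Odd (classNumber (realQuadraticField p)) := by
  have hd : (1 : ℤ) < p := by exact_mod_cast hp.one_lt
  have hsq : Squarefree (p : ℤ) := (Nat.prime_iff_prime_int.mp hp).squarefree
  have hη : ∃ η : (𝓞 (realQuadraticField p))ˣ,
      Algebra.norm ℤ (η : 𝓞 (realQuadraticField p)) = -1 := by
    obtain ⟨m, n, a, b, hmn, ⟨hm, h⟩ | ⟨h, -⟩⟩ := pell_split hd hsq
    · have hmn' : m * n = p := by exact_mod_cast hmn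
      rcases (Nat.dvd_prime hp).mp ⟨n, hmn'.symm⟩ with rfl | rfl
      · exact absurd rfl hm
      · have hn : n = 1 := by
          apply Nat.eq_of_mul_eq_mul_left hp.pos; rw [hmn', mul_one]
        subst hn
        exact exists_unit_norm_neg_one hd hsq (a := a) (b := b) (by push_cast at h; linarith)
    · omega
  refine odd_classNumber_of hd hsq (fun l hl h ↦ ?_) (fun _ _ _ _ ↦ hη)
  have hlp : l = p := by
    rcases prime_dvd_discr hd hsq hl h with h | ⟨h1, rfl⟩
    · exact (Nat.prime_dvd_prime_iff_eq hl hp).mp (by exact_mod_cast h)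
    · rcases hp.eq_two_or_odd with h | h
      · exact h.symm
      · omega
  exact isSqUpToUnit_self hd (by rw [hlp])

theorem odd_classNumber_of_prime_three_mod_four {p : ℕ} (hp : p.Prime) (h4 : p % 4 = 3) :
    Odd (classNumber (realQuadraticField p)) := by
  have hd : (1 : ℤ) < p := by exact_mod_cast hp.one_lt
  have hsq : Squarefree (p : ℤ) := (Nat.prime_iff_prime_int.mp hp).squarefree
  refine odd_classNumber_of hd hsq (fun l hl h ↦ ?_)
    (fun γ n hn h ↦ absurd h (not_norm_neg_sq hd hsq hp h4 dvd_rfl hn))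
  rcases prime_dvd_discr hd hsq hl h with h | ⟨h1, rfl⟩
  · have := (Nat.prime_dvd_prime_iff_eq hl hp).mp (by exact_mod_cast h)
    exact isSqUpToUnit_self hd (by rw [this])
  · obtain ⟨m, n, a, b, hmn, hsplit⟩ := pell_split hd hsq
    have hmn' : m * n = p := by exact_mod_cast hmn
    have hcases : (m = 1 ∧ n = p) ∨ (m = p ∧ n = 1) := by
      rcases (Nat.dvd_prime hp).mp ⟨n, hmn'.symm⟩ with rfl | rfl
      · left; exact ⟨rfl, by omega⟩
      · right; exact ⟨rfl, by apply Nat.eq_of_mul_eq_mul_left hp.pos; rw [hmn', mul_one]⟩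
    rcases hcases with ⟨rfl, rfl⟩ | ⟨rfl, rfl⟩ <;> rcases hsplit with ⟨hm, h⟩ | ⟨-, h⟩
    · exact absurd rfl hm
    · exact isSqUpToUnit_two hd (a := a) (b := b) (e := 1) (by norm_num)
        (by push_cast at h; linarith)
    · have := eq_zero_of_sq_add_sq_eq hd hsq hp h4 dvd_rfl (a := b) (b := a) (c := 1)
        (by push_cast at h; linarith)
      omega
    · exact isSqUpToUnit_two hd (a := b) (b := a) (e := -1) (by norm_num)
        (by push_cast at h; linarith)

theorem squarefree_mul_of_primes {p q : ℕ} (hp : p.Prime) (hq : q.Prime) (hpq : p ≠ q) :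
    Squarefree ((p * q : ℕ) : ℤ) := by
  rw [Int.squarefree_natCast, Nat.squarefree_mul ((Nat.coprime_primes hp hq).mpr hpq)]
  exact ⟨hp.prime.squarefree, hq.prime.squarefree⟩

theorem one_lt_mul_of_primes {p q : ℕ} (hp : p.Prime) (hq : q.Prime) :
    (1 : ℤ) < ((p * q : ℕ) : ℤ) := by
  exact_mod_cast Nat.one_lt_mul_iff.mpr ⟨hp.pos, hq.pos, Or.inl hp.one_lt⟩

/-- The class number is odd for `d = p * q` with `q ≡ 3 (mod 4)`, and `p ≡ 3 (mod 4)` or `p = 2`. -/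
theorem odd_classNumber_of_mul {p q : ℕ} (hp : p.Prime) (hq : q.Prime) (hpq : p ≠ q)
    (hq4 : q % 4 = 3) (hp4 : p = 2 ∨ p % 4 = 3) :
    Odd (classNumber (realQuadraticField ((p * q : ℕ) : ℤ))) := by
  have hd := one_lt_mul_of_primes hp hq
  have hsq := squarefree_mul_of_primes hp hq hpq
  have hqd : (q : ℤ) ∣ ((p * q : ℕ) : ℤ) := ⟨p, by push_cast; ring⟩
  have hmod : (p = 2 ∧ p * q % 4 = 2) ∨ p * q % 4 = 1 := by
    rcases hp4 with rfl | h
    · left; exact ⟨rfl, by omega⟩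
    · right; rw [Nat.mul_mod, h, hq4]
  have key : IsSqUpToUnit ((p * q : ℕ) : ℤ) p ∧ IsSqUpToUnit ((p * q : ℕ) : ℤ) q := by
    obtain ⟨m, n, a, b, hmn, ⟨hm, h⟩ | ⟨h, -⟩⟩ := pell_split hd hsq
    · have hm' := isSqUpToUnit_of_split hd hmn (e := 1) (by norm_num) h
      have hn' := isSqUpToUnit_of_split hd (m := n) (n := m) (a := b) (b := a) (e := -1)
        (by rw [mul_comm]; exact hmn) (by norm_num) (by linarith)
      have hmn' : m * n = p * q := by exact_mod_cast hmn
      obtain ⟨m₁, m₂, h₁, h₂, rfl⟩ := (Nat.dvd_mul).mp (⟨n, hmn'.symm⟩ : m ∣ p * q)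
      rcases (Nat.dvd_prime hp).mp h₁ with rfl | rfl <;>
        rcases (Nat.dvd_prime hq).mp h₂ with rfl | rfl
      · exact absurd rfl hm
      · have : n = p := by
          apply Nat.eq_of_mul_eq_mul_left hq.pos; rw [one_mul] at hmn'; rw [hmn', mul_comm]
        subst this
        rw [one_mul] at hm'
        exact ⟨hn', hm'⟩
      · have : n = q := by
          apply Nat.eq_of_mul_eq_mul_left hp.pos; rw [mul_one] at hmn'; rw [hmn']
        subst this
        rw [mul_one] at hm'
        exact ⟨hm', hn'⟩
      · have : n = 1 := by
          apply Nat.eq_of_mul_eq_mul_left (Nat.mul_pos hp.pos hq.pos); rw [hmn', mul_one]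
        subst this
        have := eq_zero_of_sq_add_sq_eq hd hsq hq hq4 hqd (a := b) (b := a) (c := 1)
          (by push_cast at h ⊢; linarith)
        omega
    · omega
  refine odd_classNumber_of hd hsq (fun l hl h ↦ ?_)
    (fun γ n hn h ↦ absurd h (not_norm_neg_sq hd hsq hq hq4 hqd hn))
  have hl' : l = p ∨ l = q := by
    rcases prime_dvd_discr hd hsq hl h with h | ⟨h1, rfl⟩
    · have h' : l ∣ p * q := by exact_mod_cast h
      rcases hl.dvd_mul.mp h' with h | h
      · left; exact (Nat.prime_dvd_prime_iff_eq hl hp).mp h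
      · right; exact (Nat.prime_dvd_prime_iff_eq hl hq).mp h
    · left; omega
  rcases hl' with rfl | rfl
  · exact key.1
  · exact key.2

/-- The inclusion of the ring of integers of `ℚ(√d)` in `ℝ`. -/
noncomputable def toReal (d : ℤ) : 𝓞 (realQuadraticField d) →+* ℝ :=
  (algebraMap (realQuadraticField d) ℝ).comp (algebraMap _ _)

theorem toReal_injective : Function.Injective (toReal d) :=
  (algebraMap (realQuadraticField d) ℝ).injective.comp RingOfIntegers.coe_injective

theorem toReal_unit_ne_zero (u : (𝓞 (realQuadraticField d))ˣ) : toReal d u ≠ 0 := by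
  rw [Ne, map_eq_zero_iff _ toReal_injective]
  exact u.ne_zero

theorem torsion_eq_one_or_neg_one {ζ : (𝓞 (realQuadraticField d))ˣ}
    (hζ : ζ ∈ Units.torsion (realQuadraticField d)) : ζ = 1 ∨ ζ = -1 := by
  rw [Units.torsion, CommGroup.mem_torsion, isOfFinOrder_iff_pow_eq_one] at hζ
  obtain ⟨n, hn, h⟩ := hζ
  have h1 : toReal d ζ ^ n = 1 := by
    rw [← map_pow, ← Units.val_pow_eq_pow_val, h, Units.val_one, map_one]
  have h2 : |toReal d ζ| = 1 := by
    have : |toReal d ζ| ^ n = 1 := by rw [← abs_pow, h1, abs_one]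
    exact (pow_eq_one_iff_of_nonneg (abs_nonneg _) hn.ne').mp this
  rcases eq_or_eq_neg_of_abs_eq h2 with h | h
  · left
    apply Units.ext; apply toReal_injective; simpa using h
  · right
    apply Units.ext; apply toReal_injective; simpa using h

/-- The unit group of a real quadratic field is generated by `-1` and one unit. -/
theorem exists_unit_generator (hd : 1 < d) (hsq : Squarefree d) :
    ∃ η : (𝓞 (realQuadraticField d))ˣ, ∀ u : (𝓞 (realQuadraticField d))ˣ,
      ∃ k : ℤ, u = η ^ k ∨ u = -η ^ k := by
  have hrank : Units.rank (realQuadraticField d) ≤ 1 := by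
    have h1 := InfinitePlace.card_add_two_mul_card_eq_rank (realQuadraticField d)
    have h2 := InfinitePlace.card_eq_nrRealPlaces_add_nrComplexPlaces (realQuadraticField d)
    rw [finrank_eq_two hd hsq] at h1
    rw [Units.rank]
    omega
  obtain ⟨η, hη⟩ : ∃ η : (𝓞 (realQuadraticField d))ˣ,
      ∀ f : Fin (Units.rank (realQuadraticField d)) → ℤ, ∃ k : ℤ,
        ∏ i, (Units.fundSystem (realQuadraticField d) i) ^ (f i) = η ^ k := by
    generalize Units.fundSystem (realQuadraticField d) = g
    revert g
    generalize Units.rank (realQuadraticField d) = r at hrank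
    intro g
    interval_cases r
    · exact ⟨1, fun f ↦ ⟨0, by simp⟩⟩
    · exact ⟨g 0, fun f ↦ ⟨f 0, by simp⟩⟩
  refine ⟨η, fun u ↦ ?_⟩
  obtain ⟨⟨ζ, f⟩, h, -⟩ := Units.exist_unique_eq_mul_prod (realQuadraticField d) u
  obtain ⟨k, hk⟩ := hη f
  refine ⟨k, ?_⟩
  dsimp only at h
  rw [hk] at h
  rcases torsion_eq_one_or_neg_one ζ.2 with h1 | h1
  · left; rw [h, h1, one_mul]
  · right; rw [h, h1, neg_one_mul]

theorem isSquare_of_pos_of_eq {u w : (𝓞 (realQuadraticField d))ˣ} (hu : 0 < toReal d u)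
    (h : u = w ^ 2 ∨ u = -w ^ 2) : ∃ w : (𝓞 (realQuadraticField d))ˣ, u = w ^ 2 := by
  rcases h with h | h
  · exact ⟨w, h⟩
  · exfalso
    rw [h] at hu
    simp only [Units.val_neg, Units.val_pow_eq_pow_val, map_neg, map_pow] at hu
    linarith [sq_nonneg (toReal d w)]

theorem isSquare_or_mul (hd : 1 < d) (hsq : Squarefree d)
    {u v : (𝓞 (realQuadraticField d))ˣ} (hu : 0 < toReal d u) (hv : 0 < toReal d v) :
    (∃ w : (𝓞 (realQuadraticField d))ˣ, u = w ^ 2) ∨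
      (∃ w : (𝓞 (realQuadraticField d))ˣ, v = w ^ 2) ∨
      ∃ w : (𝓞 (realQuadraticField d))ˣ, u * v = w ^ 2 := by
  obtain ⟨η, hη⟩ := exists_unit_generator hd hsq
  obtain ⟨k, hk⟩ := hη u
  obtain ⟨l, hl⟩ := hη v
  rcases Int.even_or_odd' k with ⟨k', hk' | hk'⟩
  · left
    refine isSquare_of_pos_of_eq (w := η ^ k') hu ?_
    rwa [← zpow_natCast, ← zpow_mul, Nat.cast_ofNat, mul_comm, ← hk']
  rcases Int.even_or_odd' l with ⟨l', hl' | hl'⟩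
  · right; left
    refine isSquare_of_pos_of_eq (w := η ^ l') hv ?_
    rwa [← zpow_natCast, ← zpow_mul, Nat.cast_ofNat, mul_comm, ← hl']
  right; right
  refine isSquare_of_pos_of_eq (w := η ^ (k' + l' + 1)) (by
    rw [Units.val_mul, map_mul]; exact mul_pos hu hv) ?_
  have : (η ^ (k' + l' + 1)) ^ 2 = η ^ k * η ^ l := by
    rw [← zpow_natCast, ← zpow_mul, ← zpow_add, hk', hl']
    congr 1
    push_cast
    ring
  rw [this]
  rcases hk with hk | hk <;> rcases hl with hl | hl <;> rw [hk, hl] <;> simp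

theorem norm_unit (u : (𝓞 (realQuadraticField d))ˣ) :
    Algebra.norm ℤ (u : 𝓞 (realQuadraticField d)) = 1 ∨
      Algebra.norm ℤ (u : 𝓞 (realQuadraticField d)) = -1 :=
  Int.isUnit_iff.mp (u.isUnit.map (Algebra.norm ℤ))

theorem norm_neg (hd : 1 < d) (hsq : Squarefree d) (x : 𝓞 (realQuadraticField d)) :
    Algebra.norm ℤ (-x) = Algebra.norm ℤ x := by
  have h : Algebra.norm ℤ (-1 : 𝓞 (realQuadraticField d)) = 1 := by
    simpa using norm_int_coords hd hsq (-1) 0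
  rw [← neg_one_mul, map_mul, h, one_mul]

/-- If some unit has norm `-1`, then every positive unit of norm `1` is a square. -/
theorem isSquare_of_norm_eq_one (hd : 1 < d) (hsq : Squarefree d)
    {η u : (𝓞 (realQuadraticField d))ˣ}
    (hη : Algebra.norm ℤ (η : 𝓞 (realQuadraticField d)) = -1) (hu : 0 < toReal d u)
    (hN : Algebra.norm ℤ (u : 𝓞 (realQuadraticField d)) = 1) :
    ∃ w : (𝓞 (realQuadraticField d))ˣ, u = w ^ 2 := by
  obtain ⟨ε, hε⟩ := exists_unit_generator hd hsq
  let N : (𝓞 (realQuadraticField d))ˣ →* ℤˣ := Units.map (Algebra.norm ℤ)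
  have hNneg : ∀ x, N (-x) = N x := fun x ↦ Units.ext (by
    simp only [N, Units.coe_map, Units.val_neg]
    exact norm_neg hd hsq _)
  have hNη : N η = -1 := Units.ext (by simpa [N] using hη)
  have hNu : N u = 1 := Units.ext (by simpa [N] using hN)
  have hNε : N ε = -1 := by
    rcases Int.units_eq_one_or (N ε) with h | h
    · exfalso
      obtain ⟨k, hk | hk⟩ := hε η
      · rw [hk, map_zpow, h, one_zpow] at hNη; exact absurd hNη (by decide)
      · rw [hk, hNneg, map_zpow, h, one_zpow] at hNη; exact absurd hNη (by decide)
    · exact h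
  obtain ⟨k, hk⟩ := hε u
  have hNk : (-1 : ℤˣ) ^ k = 1 := by
    rw [← hNε, ← map_zpow, ← hNu]
    rcases hk with hk | hk
    · rw [hk]
    · rw [hk, hNneg]
  rcases Int.even_or_odd' k with ⟨k', hk' | hk'⟩
  · refine isSquare_of_pos_of_eq (w := ε ^ k') hu ?_
    rwa [← zpow_natCast, ← zpow_mul, Nat.cast_ofNat, mul_comm, ← hk']
  · rw [hk', zpow_add, zpow_mul] at hNk
    norm_num at hNk

/-- A squarefree integer `a > 1` that is a square in the ring of integers equals `d`. -/
theorem eq_of_sq_eq (hd : 1 < d) (hsq : Squarefree d) {a : ℕ} (ha : Squarefree a) (ha1 : a ≠ 1)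
    {β : 𝓞 (realQuadraticField d)} (h : β ^ 2 = a) : (a : ℤ) = d := by
  obtain ⟨x, y, hxy, -, -⟩ := exists_two_mul_eq hd hsq β
  have hs := intRoot_sq hd
  have h1 := int_coords_ext hd hsq (a := x ^ 2 + d * y ^ 2) (b := 2 * x * y) (a' := 4 * a) (b' := 0)
    (by
      push_cast
      linear_combination 4 * h - (2 * β + x + y * intRoot hd) * hxy - y ^ 2 * hs)
  obtain ⟨h1, h2⟩ := h1
  have ha' : Squarefree (a : ℤ) := Int.squarefree_natCast.mpr ha
  have hxy0 : x = 0 ∨ y = 0 := by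
    rcases mul_eq_zero.mp h2 with h | h
    · left; omega
    · right; exact h
  rcases hxy0 with rfl | rfl
  · have hy : y % 2 = 0 := by
      by_contra hodd
      have h3 : y ^ 2 % 4 = 1 := by rw [sq_emod_four]; omega
      have h4 : d * y ^ 2 % 4 = 0 := by omega
      rw [Int.mul_emod, h3] at h4
      have := squarefree_mod_four hsq
      omega
    obtain ⟨z, rfl⟩ : ∃ z, y = 2 * z := ⟨y / 2, by omega⟩
    have h5 : (a : ℤ) = d * z ^ 2 := by linarith
    have h6 : z ^ 2 = 1 := by
      rcases Int.isUnit_iff.mp (ha' z ⟨d, by rw [h5]; ring⟩) with rfl | rfl <;> rfl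
    rw [h5, h6, mul_one]
  · exfalso
    have hx : x % 2 = 0 := by
      have := sq_emod_four x
      omega
    obtain ⟨z, rfl⟩ : ∃ z, x = 2 * z := ⟨x / 2, by omega⟩
    have h5 : (a : ℤ) = z ^ 2 := by linarith
    have h6 : z ^ 2 = 1 := by
      rcases Int.isUnit_iff.mp (ha' z ⟨1, by rw [h5]; ring⟩) with rfl | rfl <;> rfl
    omega

theorem not_isSquare_unit (hd : 1 < d) (hsq : Squarefree d) {a : ℕ} (ha : Squarefree a)
    (ha1 : a ≠ 1) (had : (a : ℤ) ≠ d) {β : 𝓞 (realQuadraticField d)}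
    {u : (𝓞 (realQuadraticField d))ˣ} (h : (a : 𝓞 (realQuadraticField d)) * u = β ^ 2)
    (hu : ∃ w : (𝓞 (realQuadraticField d))ˣ, u = w ^ 2) : False := by
  obtain ⟨w, rfl⟩ := hu
  refine had (eq_of_sq_eq hd hsq ha ha1 (β := β * (w⁻¹ : (𝓞 (realQuadraticField d))ˣ)) ?_)
  rw [mul_pow, ← h, Units.val_pow_eq_pow_val, mul_assoc, ← mul_pow, Units.mul_inv, one_pow, mul_one]

theorem toReal_pos {a : ℕ} (ha : a ≠ 0) {β : 𝓞 (realQuadraticField d)}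
    {u : (𝓞 (realQuadraticField d))ˣ} (h : (a : 𝓞 (realQuadraticField d)) * u = β ^ 2) :
    0 < toReal d u := by
  have h1 := congrArg (toReal d) h
  rw [map_mul, map_natCast, map_pow] at h1
  have ha' : (0 : ℝ) < a := by exact_mod_cast Nat.pos_of_ne_zero ha
  have h2 : 0 ≤ toReal d u := by
    by_contra hneg
    push Not at hneg
    nlinarith [sq_nonneg (toReal d β)]
  exact lt_of_le_of_ne h2 (toReal_unit_ne_zero u).symm

/-- If the class number is odd, then a generator of the square of an ideal is, up to a unit, the
square of an element. -/
theorem exists_unit_mul_eq_sq (hodd : Odd (classNumber (realQuadraticField d)))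
    {J : Ideal (𝓞 (realQuadraticField d))} {γ : 𝓞 (realQuadraticField d)} (hγ : γ ≠ 0)
    (hJ : J ^ 2 = Ideal.span {γ}) :
    ∃ (β : 𝓞 (realQuadraticField d)) (u : (𝓞 (realQuadraticField d))ˣ), γ * u = β ^ 2 := by
  have hJ0 : J ≠ ⊥ := by
    rintro rfl
    apply hγ
    rw [← Ideal.span_singleton_eq_bot, ← hJ]
    exact zero_pow two_ne_zero
  obtain ⟨β, hβ⟩ := (odd_classNumber_iff _).mp hodd J hJ0 ⟨γ, hJ⟩
  replace hβ : J = Ideal.span {β} := hβ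
  rw [hβ, Ideal.span_singleton_pow, Ideal.span_singleton_eq_span_singleton] at hJ
  obtain ⟨u, hu⟩ := hJ.symm
  exact ⟨β, u, hu⟩

/-- If `a` and `b` generate squares of ideals and none of `a`, `b`, `a * b` is a square in `ℚ(√d)`,
then the class number is even. -/
theorem not_odd_of_two (hd : 1 < d) (hsq : Squarefree d)
    {a b : ℕ} (ha1 : a ≠ 1) (hb1 : b ≠ 1) (hab : Squarefree (a * b))
    (had : (a : ℤ) ≠ d) (hbd : (b : ℤ) ≠ d) (habd : ((a * b : ℕ) : ℤ) ≠ d)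
    {I J : Ideal (𝓞 (realQuadraticField d))}
    (hI : I ^ 2 = Ideal.span {(a : 𝓞 (realQuadraticField d))})
    (hJ : J ^ 2 = Ideal.span {(b : 𝓞 (realQuadraticField d))}) :
    ¬ Odd (classNumber (realQuadraticField d)) := by
  intro hodd
  have ha := hab.of_mul_left
  have hb := hab.of_mul_right
  obtain ⟨β, u, hu⟩ := exists_unit_mul_eq_sq hodd (by exact_mod_cast ha.ne_zero) hI
  obtain ⟨γ, v, hv⟩ := exists_unit_mul_eq_sq hodd (by exact_mod_cast hb.ne_zero) hJ
  rcases isSquare_or_mul hd hsq (toReal_pos ha.ne_zero hu) (toReal_pos hb.ne_zero hv) with h | h | h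
  · exact not_isSquare_unit hd hsq ha ha1 had hu h
  · exact not_isSquare_unit hd hsq hb hb1 hbd hv h
  · refine not_isSquare_unit hd hsq hab (fun h ↦ ha1 (Nat.eq_one_of_mul_eq_one_right h)) habd
      (β := β * γ) ?_ h
    push_cast
    rw [mul_pow, ← hu, ← hv]; ring

/-- For a divisor `m` of `d`, the ideal `(m, √d)` has square `(m)`. -/
theorem exists_sq_eq_span_of_dvd (hd : 1 < d) {m n : ℕ} (hmn : ((m * n : ℕ) : ℤ) = d)
    (hcop : m.Coprime n) :
    ∃ J : Ideal (𝓞 (realQuadraticField d)),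
      J ^ 2 = Ideal.span {(m : 𝓞 (realQuadraticField d))} := by
  have hs := intRoot_sq hd
  set s := intRoot hd
  have hmn' : (m * n : 𝓞 (realQuadraticField d)) = d := by
    exact_mod_cast congrArg (Int.cast (R := 𝓞 (realQuadraticField d))) hmn
  obtain ⟨x, y, hxy⟩ := Nat.isCoprime_iff_coprime.mpr hcop
  have hxy' : (x * m + y * n : 𝓞 (realQuadraticField d)) = 1 := by
    exact_mod_cast congrArg (Int.cast (R := 𝓞 (realQuadraticField d))) hxy
  refine ⟨Ideal.span {(m : 𝓞 (realQuadraticField d)), s}, ?_⟩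
  rw [sq, Ideal.span_pair_mul_span_pair]
  apply le_antisymm
  · rw [Ideal.span_le]
    rintro z (rfl | rfl | rfl | rfl) <;> rw [SetLike.mem_coe, Ideal.mem_span_singleton]
    · exact dvd_mul_right _ _
    · exact dvd_mul_right _ _
    · exact dvd_mul_left _ _
    · exact ⟨n, by rw [← sq, hs, hmn']⟩
  · rw [Ideal.span_singleton_le_iff_mem]
    have : (m : 𝓞 (realQuadraticField d)) = x * (m * m) + y * (s * s) := by
      linear_combination -m * hxy' - y * hs + y * hmn'
    refine Set.mem_of_eq_of_mem this (SetLike.mem_coe.mpr ?_)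
    refine Ideal.add_mem _ (Ideal.mul_mem_left _ _ (Ideal.subset_span ?_))
      (Ideal.mul_mem_left _ _ (Ideal.subset_span ?_)) <;> simp

/-- For `d ≡ 3 (mod 4)`, the ideal `(2, 1 + √d)` has square `(2)`. -/
theorem exists_sq_eq_span_two (hd : 1 < d) (h4 : d % 4 = 3) :
    ∃ J : Ideal (𝓞 (realQuadraticField d)),
      J ^ 2 = Ideal.span {((2 : ℕ) : 𝓞 (realQuadraticField d))} := by
  have hs := intRoot_sq hd
  set s := intRoot hd
  obtain ⟨k, hk⟩ : ∃ k : ℤ, d = 4 * k + 3 := ⟨d / 4, by omega⟩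
  have hk' : (d : 𝓞 (realQuadraticField d)) = 4 * k + 3 := by
    exact_mod_cast congrArg (Int.cast (R := 𝓞 (realQuadraticField d))) hk
  refine ⟨Ideal.span {2, 1 + s}, ?_⟩
  rw [sq, Ideal.span_pair_mul_span_pair]
  apply le_antisymm
  · rw [Ideal.span_le]
    rintro z (rfl | rfl | rfl | rfl) <;> rw [SetLike.mem_coe, Ideal.mem_span_singleton] <;>
      push_cast
    · exact dvd_mul_right _ _
    · exact dvd_mul_right _ _
    · exact dvd_mul_left _ _
    · exact ⟨2 * k + 2 + s, by linear_combination hs + hk'⟩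
  · rw [Ideal.span_singleton_le_iff_mem]
    have : ((2 : ℕ) : 𝓞 (realQuadraticField d)) =
        1 * ((1 + s) * (1 + s)) + -1 * (2 * (1 + s)) + (-k) * (2 * 2) := by
      push_cast
      linear_combination -hs - hk'
    refine Set.mem_of_eq_of_mem this (SetLike.mem_coe.mpr ?_)
    refine Ideal.add_mem _ (Ideal.add_mem _ (Ideal.mul_mem_left _ _ (Ideal.subset_span ?_))
      (Ideal.mul_mem_left _ _ (Ideal.subset_span ?_)))
      (Ideal.mul_mem_left _ _ (Ideal.subset_span ?_)) <;> simp

/-- If `d = u ^ 2 + v ^ 2` with `v` coprime to `2 * u`, the ideal `(u + √d, v)` has square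
`(u + √d)`. -/
theorem exists_sq_eq_span_add (hd : 1 < d) {u v : ℤ} (huv : d = u ^ 2 + v ^ 2)
    (hcop : IsCoprime (2 * u) v) :
    ∃ J : Ideal (𝓞 (realQuadraticField d)), J ^ 2 = Ideal.span {u + intRoot hd} := by
  have hs := intRoot_sq hd
  set s := intRoot hd
  have huv' : (d : 𝓞 (realQuadraticField d)) = u ^ 2 + v ^ 2 := by
    exact_mod_cast congrArg (Int.cast (R := 𝓞 (realQuadraticField d))) huv
  obtain ⟨x, y, hxy⟩ := hcop
  have hxy' : (x * (2 * u) + y * v : 𝓞 (realQuadraticField d)) = 1 := by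
    exact_mod_cast congrArg (Int.cast (R := 𝓞 (realQuadraticField d))) hxy
  refine ⟨Ideal.span {u + s, (v : 𝓞 (realQuadraticField d))}, ?_⟩
  rw [sq, Ideal.span_pair_mul_span_pair]
  apply le_antisymm
  · rw [Ideal.span_le]
    rintro z (rfl | rfl | rfl | rfl) <;> rw [SetLike.mem_coe, Ideal.mem_span_singleton]
    · exact dvd_mul_right _ _
    · exact dvd_mul_right _ _
    · exact dvd_mul_left _ _
    · exact ⟨s - u, by linear_combination -hs - huv'⟩
  · rw [Ideal.span_singleton_le_iff_mem]
    have : (u + s : 𝓞 (realQuadraticField d)) =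
        x * ((u + s) * (u + s)) + -x * (v * v) + y * ((u + s) * v) := by
      linear_combination -(u + s) * hxy' - x * hs - x * huv'
    refine Set.mem_of_eq_of_mem this (SetLike.mem_coe.mpr ?_)
    refine Ideal.add_mem _ (Ideal.add_mem _ (Ideal.mul_mem_left _ _ (Ideal.subset_span ?_))
      (Ideal.mul_mem_left _ _ (Ideal.subset_span ?_)))
      (Ideal.mul_mem_left _ _ (Ideal.subset_span ?_)) <;> simp

/-- The class number is even if `d` is a sum of two squares and not a prime. -/
theorem not_odd_of_sum_two_squares (hd : 1 < d) (hsq : Squarefree d) {m n : ℕ} (hm : m ≠ 1)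
    (hn : n ≠ 1) (hmn : ((m * n : ℕ) : ℤ) = d) {u v : ℤ} (huv : d = u ^ 2 + v ^ 2)
    (hv : v % 2 = 1) : ¬ Odd (classNumber (realQuadraticField d)) := by
  intro hodd
  have hmnsq : Squarefree (m * n) := by rw [← Int.squarefree_natCast, hmn]; exact hsq
  have hmsq := hmnsq.of_mul_left
  have hcop : IsCoprime (2 * u) v := by
    refine IsCoprime.mul_left ?_ ?_
    · exact ⟨-(v / 2), 1, by omega⟩
    · rw [Int.isCoprime_iff_gcd_eq_one]
      obtain ⟨u', hu'⟩ := Int.gcd_dvd_left u v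
      obtain ⟨v', hv'⟩ := Int.gcd_dvd_right u v
      have := hsq (Int.gcd u v) ⟨u' ^ 2 + v' ^ 2, by
        rw [huv]; nth_rewrite 1 [hu']; nth_rewrite 2 [hv']; ring⟩
      simpa [Int.isUnit_iff] using this
  have hη : ∃ η : (𝓞 (realQuadraticField d))ˣ,
      Algebra.norm ℤ (η : 𝓞 (realQuadraticField d)) = -1 := by
    obtain ⟨J, hJ⟩ := exists_sq_eq_span_add hd huv hcop
    have hN : Algebra.norm ℤ (u + intRoot hd : 𝓞 (realQuadraticField d)) = -v ^ 2 := by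
      have := norm_int_coords hd hsq u 1
      rw [Int.cast_one, one_mul] at this
      rw [this, huv]; ring
    have hv0 : 0 < v ^ 2 := by
      have : v ≠ 0 := by omega
      positivity
    have h0 : (u + intRoot hd : 𝓞 (realQuadraticField d)) ≠ 0 := by
      intro h
      rw [h, Algebra.norm_zero] at hN
      omega
    obtain ⟨β, w, hw⟩ := exists_unit_mul_eq_sq hodd h0 hJ
    refine ⟨w, (norm_unit w).resolve_left fun h1 ↦ ?_⟩
    have h2 := congrArg (Algebra.norm ℤ) hw
    rw [map_mul, map_pow, hN, h1] at h2
    nlinarith [sq_nonneg (Algebra.norm ℤ β)]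
  obtain ⟨η, hη⟩ := hη
  obtain ⟨J, hJ⟩ := exists_sq_eq_span_of_dvd hd hmn
    (Nat.coprime_of_squarefree_mul hmnsq)
  obtain ⟨β, w, hw⟩ := exists_unit_mul_eq_sq hodd (by exact_mod_cast hmsq.ne_zero) hJ
  refine not_isSquare_unit hd hsq hmsq hm ?_ hw
    (isSquare_of_norm_eq_one hd hsq hη (toReal_pos hmsq.ne_zero hw) ?_)
  · rw [← hmn]
    intro h
    have h' : m * 1 = m * n := by rw [mul_one]; exact_mod_cast h
    exact hn (Nat.eq_of_mul_eq_mul_left (Nat.pos_of_ne_zero hmsq.ne_zero) h').symm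
  · refine (norm_unit w).resolve_right fun h1 ↦ ?_
    have h2 := congrArg (Algebra.norm ℤ) hw
    have h3 : Algebra.norm ℤ (m : 𝓞 (realQuadraticField d)) = m ^ 2 := by
      simpa using norm_int_coords hd hsq m 0
    rw [map_mul, map_pow, h3, h1] at h2
    have : (0 : ℤ) < m := by exact_mod_cast Nat.pos_of_ne_zero hmsq.ne_zero
    nlinarith [sq_nonneg (Algebra.norm ℤ β), pow_pos this 2]

theorem numRamifiedPrimes_eq (K : Type*) [Field K] [NumberField K] :
    numRamifiedPrimes K = {p : ℕ | p.Prime ∧ (p : ℤ) ∣ discr K}.ncard := by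
  rw [numRamifiedPrimes]
  congr 1
  ext p
  refine and_congr_right fun hp ↦ ?_
  rw [← not_dvd_discr_iff_isUnramifiedIn K (𝓞 K) (Nat.prime_iff_prime_int.mp hp), not_not]

theorem numRamifiedPrimes_ne_one {K : Type*} [Field K] [NumberField K] {p q : ℕ} (hp : p.Prime)
    (hq : q.Prime) (hpq : p ≠ q) (hpd : (p : ℤ) ∣ discr K) (hqd : (q : ℤ) ∣ discr K) :
    numRamifiedPrimes K ≠ 1 := by
  rw [numRamifiedPrimes_eq, Ne, Set.ncard_eq_one]
  rintro ⟨x, hx⟩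
  have h1 : p ∈ ({x} : Set ℕ) := hx ▸ (⟨hp, hpd⟩ : p.Prime ∧ (p : ℤ) ∣ discr K)
  have h2 : q ∈ ({x} : Set ℕ) := hx ▸ (⟨hq, hqd⟩ : q.Prime ∧ (q : ℤ) ∣ discr K)
  exact hpq (h1.trans h2.symm)

theorem numRamifiedPrimes_of_prime {p : ℕ} (hp : p.Prime) (h4 : p % 4 ≠ 3) :
    numRamifiedPrimes (realQuadraticField p) = 1 := by
  have hd : (1 : ℤ) < p := by exact_mod_cast hp.one_lt
  have hsq : Squarefree (p : ℤ) := (Nat.prime_iff_prime_int.mp hp).squarefree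
  rw [numRamifiedPrimes_eq, Set.ncard_eq_one]
  refine ⟨p, Set.eq_singleton_iff_unique_mem.mpr
    ⟨⟨hp, dvd_discr_of_dvd hd hsq dvd_rfl⟩, fun l hl ↦ ?_⟩⟩
  rcases prime_dvd_discr hd hsq hl.1 hl.2 with h | ⟨h1, rfl⟩
  · exact (Nat.prime_dvd_prime_iff_eq hl.1 hp).mp (by exact_mod_cast h)
  · rcases hp.eq_two_or_odd with h | h
    · exact h.symm
    · omega

theorem isPrimeDiscriminant_neg_prime {p : ℕ} (hp : p.Prime) (h4 : p % 4 = 3) :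
    IsPrimeDiscriminant (-p) := by
  refine ⟨⟨-p, ?_, by omega, ?_⟩, p, ⟨hp, by simp⟩, fun l hl ↦ ?_⟩
  · exact (Nat.prime_iff_prime_int.mp hp).neg.squarefree
  · rw [if_pos (by omega)]
  · exact (Nat.prime_dvd_prime_iff_eq hl.1 hp).mp (by exact_mod_cast (Int.dvd_neg.mp hl.2))

theorem existsUnique_prime_dvd_neg_two_pow {k : ℕ} (hk : k ≠ 0) :
    ∃! p : ℕ, p.Prime ∧ (p : ℤ) ∣ -2 ^ k := by
  refine ⟨2, ⟨Nat.prime_two, ?_⟩, fun l hl ↦ ?_⟩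
  · rw [Int.dvd_neg]; exact dvd_pow_self _ hk
  · have h : l ∣ 2 ^ k := by exact_mod_cast (Int.dvd_neg.mp hl.2)
    exact (Nat.prime_dvd_prime_iff_eq hl.1 Nat.prime_two).mp (hl.1.dvd_of_dvd_pow h)

theorem isPrimeDiscriminant_neg_four : IsPrimeDiscriminant (-4) := by
  refine ⟨⟨-1, isUnit_one.neg.squarefree, by norm_num, by norm_num⟩, ?_⟩
  simpa using existsUnique_prime_dvd_neg_two_pow (k := 2) (by norm_num)

theorem isPrimeDiscriminant_neg_eight : IsPrimeDiscriminant (-8) := by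
  refine ⟨⟨-2, Int.prime_two.neg.squarefree, by norm_num, by norm_num⟩, ?_⟩
  simpa using existsUnique_prime_dvd_neg_two_pow (k := 3) (by norm_num)

theorem not_dvd_neg_primeDiscriminant {m : ℤ} (hm : IsPrimeDiscriminant m) (hneg : m < 0) {p : ℕ}
    (hp : p.Prime) (h4 : p % 4 = 1) : ¬ (p : ℤ) ∣ m := by
  intro hpm
  obtain ⟨⟨e, he, -, hme⟩, hu⟩ := hm
  by_cases he4 : e % 4 = 1
  · rw [if_pos he4] at hme
    subst hme
    obtain ⟨c, rfl⟩ := hpm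
    have hc : c.natAbs = 1 := by
      by_contra hc
      obtain ⟨l, hl, hlc⟩ := Nat.exists_prime_and_dvd hc
      have hlc' : (l : ℤ) ∣ c := Int.natCast_dvd.mpr hlc
      have hlp : l = p := hu.unique ⟨hl, hlc'.mul_left _⟩ ⟨hp, dvd_mul_right _ _⟩
      subst hlp
      have := he l (mul_dvd_mul_left _ hlc')
      rw [Int.isUnit_iff] at this
      have := hl.one_lt
      omega
    rcases Int.natAbs_eq_iff.mp hc with rfl | rfl
    · push_cast at hneg; omega
    · push_cast at he4; omega
  · rw [if_neg he4] at hme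
    have h2 : 2 = p := hu.unique ⟨Nat.prime_two, by rw [hme]; exact ⟨2 * e, by push_cast; ring⟩⟩
      ⟨hp, hpm⟩
    omega

theorem false_of_three_primes {d₁ d₂ : ℤ} (h₁ : IsPrimeDiscriminant d₁)
    (h₂ : IsPrimeDiscriminant d₂) {p q r : ℕ} (hp : p.Prime) (hq : q.Prime) (hr : r.Prime)
    (hpq : p ≠ q) (hpr : p ≠ r) (hqr : q ≠ r) (hpd : (p : ℤ) ∣ d₁ * d₂) (hqd : (q : ℤ) ∣ d₁ * d₂)
    (hrd : (r : ℤ) ∣ d₁ * d₂) : False := by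
  have key : ∀ {l : ℕ}, l.Prime → (l : ℤ) ∣ d₁ * d₂ → (l : ℤ) ∣ d₁ ∨ (l : ℤ) ∣ d₂ :=
    fun hl h ↦ (Nat.prime_iff_prime_int.mp hl).dvd_or_dvd h
  have u₁ : ∀ {l l' : ℕ}, l.Prime → l'.Prime → (l : ℤ) ∣ d₁ → (l' : ℤ) ∣ d₁ → l = l' :=
    fun hl hl' h h' ↦ h₁.2.unique ⟨hl, h⟩ ⟨hl', h'⟩
  have u₂ : ∀ {l l' : ℕ}, l.Prime → l'.Prime → (l : ℤ) ∣ d₂ → (l' : ℤ) ∣ d₂ → l = l' :=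
    fun hl hl' h h' ↦ h₂.2.unique ⟨hl, h⟩ ⟨hl', h'⟩
  rcases key hp hpd with h | h <;> rcases key hq hqd with hdq | hdq <;>
    rcases key hr hrd with hdr | hdr
  · exact hpq (u₁ hp hq h hdq)
  · exact hpq (u₁ hp hq h hdq)
  · exact hpr (u₁ hp hr h hdr)
  · exact hqr (u₂ hq hr hdq hdr)
  · exact hqr (u₁ hq hr hdq hdr)
  · exact hpr (u₂ hp hr h hdr)
  · exact hpq (u₂ hp hq h hdq)
  · exact hpq (u₂ hp hq h hdq)

/-- The condition on the discriminant that characterises odd class numbers. -/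
def HasOddType (d : ℤ) : Prop :=
  numRamifiedPrimes (realQuadraticField d) = 1 ∨
    ∃ d₁ d₂ : ℤ, IsPrimeDiscriminant d₁ ∧ IsPrimeDiscriminant d₂ ∧ d₁ < 0 ∧ d₂ < 0 ∧
      discr (realQuadraticField d) = d₁ * d₂

theorem not_hasOddType_of_three_primes {p q r : ℕ} (hp : p.Prime) (hq : q.Prime)
    (hr : r.Prime) (hpq : p ≠ q) (hpr : p ≠ r) (hqr : q ≠ r)
    (hpd : (p : ℤ) ∣ discr (realQuadraticField d)) (hqd : (q : ℤ) ∣ discr (realQuadraticField d))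
    (hrd : (r : ℤ) ∣ discr (realQuadraticField d)) : ¬ HasOddType d := by
  rintro (h | ⟨d₁, d₂, h₁, h₂, -, -, h⟩)
  · exact numRamifiedPrimes_ne_one hp hq hpq hpd hqd h
  · rw [h] at hpd hqd hrd
    exact false_of_three_primes h₁ h₂ hp hq hr hpq hpr hqr hpd hqd hrd

theorem hasOddType_of_prime {p : ℕ} (hp : p.Prime) : HasOddType p := by
  have hd : (1 : ℤ) < p := by exact_mod_cast hp.one_lt
  have hsq : Squarefree (p : ℤ) := (Nat.prime_iff_prime_int.mp hp).squarefree
  by_cases h4 : p % 4 = 3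
  · refine Or.inr ⟨-4, -p, isPrimeDiscriminant_neg_four, isPrimeDiscriminant_neg_prime hp h4,
      by norm_num, by omega, ?_⟩
    rw [discr_of_mod_four_ne_one hd hsq (by omega)]
    ring
  · exact Or.inl (numRamifiedPrimes_of_prime hp h4)

theorem hasOddType_of_mul {p q : ℕ} (hp : p.Prime) (hq : q.Prime) (hpq : p ≠ q)
    (hq4 : q % 4 = 3) (hp4 : p = 2 ∨ p % 4 = 3) : HasOddType ((p * q : ℕ) : ℤ) := by
  have hd := one_lt_mul_of_primes hp hq
  have hsq := squarefree_mul_of_primes hp hq hpq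
  have hq0 := hq.pos
  rcases hp4 with rfl | hp4
  · refine Or.inr ⟨-8, -q, isPrimeDiscriminant_neg_eight, isPrimeDiscriminant_neg_prime hq hq4,
      by norm_num, by omega, ?_⟩
    rw [discr_of_mod_four_ne_one hd hsq (by omega)]
    push_cast
    ring
  · refine Or.inr ⟨-p, -q, isPrimeDiscriminant_neg_prime hp hp4,
      isPrimeDiscriminant_neg_prime hq hq4, by omega, by omega, ?_⟩
    have h1 : p * q % 4 = 1 := by rw [Nat.mul_mod, hp4, hq4]
    rw [discr_of_mod_four_eq_one hd hsq (by omega)]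
    push_cast
    ring

theorem exists_sq_add_sq_odd {D : ℕ} (hsq : Squarefree (D : ℤ))
    (h : ∀ l : ℕ, l.Prime → l ∣ D → l % 4 ≠ 3) :
    ∃ u v : ℤ, (D : ℤ) = u ^ 2 + v ^ 2 ∧ v % 2 = 1 := by
  obtain ⟨x, y, hxy⟩ := (Nat.eq_sq_add_sq_iff (n := D)).mpr fun l hl h4 ↦
    absurd h4 (h l (Nat.prime_of_mem_primeFactors hl) (Nat.dvd_of_mem_primeFactors hl))
  have hxy' : (D : ℤ) = x ^ 2 + y ^ 2 := by exact_mod_cast hxy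
  by_cases hy : (y : ℤ) % 2 = 1
  · exact ⟨x, y, hxy', hy⟩
  · refine ⟨y, x, by rw [hxy']; ring, ?_⟩
    by_contra hx
    have h0 := squarefree_mod_four hsq
    have h1 := sq_emod_four x
    have h2 := sq_emod_four y
    omega

/-- Both sides fail for `d = p * q` with `p ≡ 1 (mod 4)` and `q ≢ 3 (mod 4)`. -/
theorem not_odd_and_not_hasOddType_of_mul {p q : ℕ} (hp : p.Prime) (hq : q.Prime) (hpq : p ≠ q)
    (hp4 : p % 4 = 1) (hq4 : q % 4 ≠ 3) :
    ¬ Odd (classNumber (realQuadraticField ((p * q : ℕ) : ℤ))) ∧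
      ¬ HasOddType ((p * q : ℕ) : ℤ) := by
  have hd := one_lt_mul_of_primes hp hq
  have hsq := squarefree_mul_of_primes hp hq hpq
  have hpd := dvd_discr_of_dvd hd hsq (l := p) ⟨q, by push_cast; ring⟩
  have hqd := dvd_discr_of_dvd hd hsq (l := q) ⟨p, by push_cast; ring⟩
  constructor
  · obtain ⟨u, v, huv, hv⟩ := exists_sq_add_sq_odd hsq fun l hl hld ↦ by
      rcases hl.dvd_mul.mp hld with h | h
      · rw [(Nat.prime_dvd_prime_iff_eq hl hp).mp h]; omega
      · rw [(Nat.prime_dvd_prime_iff_eq hl hq).mp h]; exact hq4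
    exact not_odd_of_sum_two_squares hd hsq hp.ne_one hq.ne_one rfl huv hv
  · rintro (h | ⟨d₁, d₂, h₁, h₂, hn₁, hn₂, h⟩)
    · exact numRamifiedPrimes_ne_one hp hq hpq hpd hqd h
    · rw [h] at hpd
      rcases (Nat.prime_iff_prime_int.mp hp).dvd_or_dvd hpd with hdvd | hdvd
      · exact not_dvd_neg_primeDiscriminant h₁ hn₁ hp hp4 hdvd
      · exact not_dvd_neg_primeDiscriminant h₂ hn₂ hp hp4 hdvd

/-- Both sides fail for `d = p * q` with `p ≡ 1 (mod 4)` and `q ≡ 3 (mod 4)`. -/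
theorem not_odd_and_not_hasOddType_of_mod_four_eq_three {p q : ℕ} (hp : p.Prime) (hq : q.Prime)
    (hp4 : p % 4 = 1) (hq4 : q % 4 = 3) :
    ¬ Odd (classNumber (realQuadraticField ((p * q : ℕ) : ℤ))) ∧
      ¬ HasOddType ((p * q : ℕ) : ℤ) := by
  have hpq : p ≠ q := by rintro rfl; omega
  have hp2 : 2 ≠ p := by rintro rfl; omega
  have hq2 : 2 ≠ q := by rintro rfl; omega
  have hd := one_lt_mul_of_primes hp hq
  have hsq := squarefree_mul_of_primes hp hq hpq
  have h4 : p * q % 4 = 3 := by rw [Nat.mul_mod, hp4, hq4]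
  have hpd := dvd_discr_of_dvd hd hsq (l := p) ⟨q, by push_cast; ring⟩
  have hqd := dvd_discr_of_dvd hd hsq (l := q) ⟨p, by push_cast; ring⟩
  constructor
  · obtain ⟨I, hI⟩ := exists_sq_eq_span_two hd (by omega)
    obtain ⟨J, hJ⟩ := exists_sq_eq_span_of_dvd hd rfl ((Nat.coprime_primes hp hq).mpr hpq)
    refine not_odd_of_two hd hsq (by norm_num) hp.ne_one ?_ (by omega) ?_ ?_ hI hJ
    · exact Int.squarefree_natCast.mp (squarefree_mul_of_primes Nat.prime_two hp hp2)
    · have := Nat.mul_lt_mul_of_pos_left hq.one_lt hp.pos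
      omega
    · omega
  · refine not_hasOddType_of_three_primes Nat.prime_two hp hq hp2 hq2 hpq ?_ hpd hqd
    rw [discr_of_mod_four_ne_one hd hsq (by omega)]
    exact ⟨2 * ((p * q : ℕ) : ℤ), by push_cast; ring⟩

/-- Both sides fail if `d` has at least three prime factors. -/
theorem not_odd_and_not_hasOddType_of_three_factors {p q e : ℕ} (hp : p.Prime) (hq : q.Prime)
    (he : e ≠ 1) (hsq : Squarefree ((p * (q * e) : ℕ) : ℤ)) :
    ¬ Odd (classNumber (realQuadraticField ((p * (q * e) : ℕ) : ℤ))) ∧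
      ¬ HasOddType ((p * (q * e) : ℕ) : ℤ) := by
  have hsqn := Int.squarefree_natCast.mp hsq
  have he0 : 0 < e := by
    rcases Nat.eq_zero_or_pos e with rfl | h
    · simp at hsqn
    · exact h
  have hd : (1 : ℤ) < ((p * (q * e) : ℕ) : ℤ) := by
    exact_mod_cast Nat.one_lt_mul_iff.mpr ⟨hp.pos, Nat.mul_pos hq.pos he0, Or.inl hp.one_lt⟩
  have hcop := Nat.coprime_of_squarefree_mul hsqn
  have hsqqe := hsqn.of_mul_right
  have hcop2 := Nat.coprime_of_squarefree_mul hsqqe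
  have hpq : p ≠ q := by
    rintro rfl
    exact hp.one_lt.ne' (Nat.Coprime.eq_one_of_dvd hcop (dvd_mul_right _ _))
  obtain ⟨r, hr, hre⟩ := Nat.exists_prime_and_dvd he
  have hpr : p ≠ r := by
    rintro rfl
    exact hp.one_lt.ne' (Nat.Coprime.eq_one_of_dvd hcop (hre.mul_left _))
  have hqr : q ≠ r := by
    rintro rfl
    exact hq.one_lt.ne' (Nat.Coprime.eq_one_of_dvd hcop2 hre)
  constructor
  · obtain ⟨I, hI⟩ := exists_sq_eq_span_of_dvd hd rfl hcop
    obtain ⟨J, hJ⟩ := exists_sq_eq_span_of_dvd hd (m := q) (n := p * e)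
      (by push_cast; ring) (Nat.Coprime.mul_right ((Nat.coprime_primes hq hp).mpr hpq.symm) hcop2)
    have he1 : 1 < e := by omega
    have hlt := Nat.mul_lt_mul_of_pos_left he1 (Nat.mul_pos hp.pos hq.pos)
    have hplt := Nat.mul_lt_mul_of_pos_left hq.one_lt hp.pos
    have hqlt := Nat.mul_lt_mul_of_pos_right hp.one_lt hq.pos
    rw [mul_one, mul_assoc] at hlt
    refine not_odd_of_two hd hsq hp.ne_one hq.ne_one ?_ ?_ ?_ ?_ hI hJ
    · exact Int.squarefree_natCast.mp (squarefree_mul_of_primes hp hq hpq)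
    all_goals norm_cast; omega
  · refine not_hasOddType_of_three_primes hp hq hr hpq hpr hqr ?_ ?_ ?_ <;>
      refine dvd_discr_of_dvd hd hsq (Int.natCast_dvd_natCast.mpr ?_)
    · exact dvd_mul_right _ _
    · exact (dvd_mul_right _ _).mul_left _
    · exact (hre.mul_left _).mul_left _

theorem odd_iff_of_mul {p q : ℕ} (hp : p.Prime) (hq : q.Prime) (hpq : p ≠ q) :
    Odd (classNumber (realQuadraticField ((p * q : ℕ) : ℤ))) ↔ HasOddType ((p * q : ℕ) : ℤ) := by
  have key : ∀ {p q : ℕ}, p.Prime → q.Prime → p ≠ q → (q % 4 = 3 ∨ (q % 4 = 1 ∧ p % 4 ≠ 3)) →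
      (Odd (classNumber (realQuadraticField ((p * q : ℕ) : ℤ))) ↔
        HasOddType ((p * q : ℕ) : ℤ)) := by
    intro p q hp hq hpq h
    rcases h with hq4 | ⟨hq4, hp4⟩
    · have hp4 : p % 4 = 1 ∨ (p = 2 ∨ p % 4 = 3) := by
        rcases hp.eq_two_or_odd with h | h <;> omega
      rcases hp4 with hp4 | hp4
      · have := not_odd_and_not_hasOddType_of_mod_four_eq_three hp hq hp4 hq4
        exact iff_of_false this.1 this.2
      · exact iff_of_true (odd_classNumber_of_mul hp hq hpq hq4 hp4)
          (hasOddType_of_mul hp hq hpq hq4 hp4)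
    · have := not_odd_and_not_hasOddType_of_mul hq hp hpq.symm hq4 hp4
      rw [mul_comm] at this
      exact iff_of_false this.1 this.2
  by_cases h : q % 4 = 3 ∨ (q % 4 = 1 ∧ p % 4 ≠ 3)
  · exact key hp hq hpq h
  · rw [mul_comm p q]
    refine key hq hp hpq.symm ?_
    rcases hp.eq_two_or_odd with h1 | h1 <;> rcases hq.eq_two_or_odd with h2 | h2 <;> omega

end RealQuadratic

open RealQuadratic

theorem mainTheorem1 (d : ℤ) (hd : 1 < d) (hsq : Squarefree d) :
    Odd (classNumber (realQuadraticField d)) ↔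
      numRamifiedPrimes (realQuadraticField d) = 1 ∨
        ∃ d₁ d₂ : ℤ, IsPrimeDiscriminant d₁ ∧ IsPrimeDiscriminant d₂ ∧ d₁ < 0 ∧ d₂ < 0 ∧
          discr (realQuadraticField d) = d₁ * d₂ := by
  change _ ↔ HasOddType d
  obtain ⟨D, rfl⟩ := Int.eq_ofNat_of_zero_le (show 0 ≤ d by omega)
  have hD : D ≠ 1 := by rintro rfl; simp at hd
  obtain ⟨p, hp, c, rfl⟩ := Nat.exists_prime_and_dvd hD
  by_cases hc : c = 1
  · subst hc
    rw [mul_one]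
    refine iff_of_true ?_ (hasOddType_of_prime hp)
    by_cases h4 : p % 4 = 3
    · exact odd_classNumber_of_prime_three_mod_four hp h4
    · exact odd_classNumber_of_prime hp h4
  obtain ⟨q, hq, e, rfl⟩ := Nat.exists_prime_and_dvd hc
  by_cases he : e = 1
  · subst he
    rw [mul_one] at hsq ⊢
    refine odd_iff_of_mul hp hq ?_
    rintro rfl
    exact hp.ne_one (Nat.isUnit_iff.mp (Int.squarefree_natCast.mp hsq p dvd_rfl))
  · have := not_odd_and_not_hasOddType_of_three_factors hp hq he hsq
    exact iff_of_false this.1 this.2
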